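/- **Objects.** The weight $|\mathcal T|$ of a binary tree $\mathcal T$ is one plus its number of nodes, i.e. its number of empty subtrees; the weight $|m|$ of a node $m$ is the weight of the subtree rooted at $m$. An empty tree (of weight $1$) is also seen as an infinite complete binary tree whose nodes of depth $d$ have weight $2^{-d}$. The left and right children of $n$ are $n_1, n_2$, those of $n_i$ are $n_{i1}, n_{i2}$, and so on. A $\mathsf{GCB}(\alpha,\beta)$-tree is a binary search tree in which every node $n$ satisfies $\max\{|n_1|,|n_2|\}\le\alpha|n|$ and $\max\{|n_{11}|,|n_{12}|,|n_{21}|,|n_{22}|\}\le\beta|n|$. **Rotations.** Let $n$ be the root. The simple rotation makes $n_1$ the root, with left subtree $n_{11}$ and right child $n$, whose subtrees are $n_{12}$ and $n_2$. The double rotation makes $n_{12}$ the root, with left child $n_1$, whose subtrees are $n_{11}, n_{121}$, and right child $n$, whose subtrees are $n_{122}, n_2$. **Balancing.** $\mathsf C(u,v)$-balancing: if $|n_1|>u|n|$, perform the simple rotation when $|n_{11}|\ge(1-v)|n|$ and the double rotation when $|n_{11}|<(1-v)|n|$; symmetrically (mirror rotations, with $n_2,n_{22}$) if $|n_2|>u|n|$;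 if $\max\{|n_1|,|n_2|\}\le u|n|$, do nothing. $\mathsf{GC}(y)$-balancing: perform the simple rotation if $|n_{11}|>y|n|$, its mirror image if $|n_{22}|>y|n|$, the double rotation if $|n_{12}|>y|n|$, its mirror image if $|n_{21}|>y|n|$, and nothing if no grandchild of $n$ has weight greater than $y|n|$. $\mathsf{CGC}(u,v,y,\hat y)$-balancing: apply $\mathsf C(u,v)$-balancing; if this changed the tree, apply $\mathsf{GC}(\hat y)$-balancing to the left and right subtrees, and then to the whole tree; otherwise, apply $\mathsf{GC}(y)$-balancing to the tree. **Bottom-up update.** Put $$\hat\alpha=\frac{1-2\alpha+6\alpha^2-\sqrt{(1-\alpha)(5-\alpha)}}{5(2\alpha-1)},\qquad \hat\beta=\frac{1+\alpha-\sqrt{(1-\alpha)^2+4\alpha(\alpha^2-\beta)}}{2(1-\alpha^2+\beta)}\,\alpha .$$ To insert a key in, or delete a key from, a tree with at most $11$ nodes, insert or delete it (if possible) and rearrange the result into any binary search tree with the same keys in which the weights of two siblings always differ by at most $1$. In a tree with at least $12$ nodes, first update recursively the (left or right) subtree in which the leaf to be inserted or deleted lies; then, if the update was not redundant (a redundant update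 inserts a key already present, or deletes an absent one), apply $\mathsf{CGC}(\alpha,\hat\alpha,\beta,\hat\beta)$-balancing to the tree. If a key to be inserted is the root's key, nothing is done. To delete the root's key, delete its successor from the right subtree instead, and replace the root's key with that successor. **Theorem.** Let $\alpha,\beta$ be real numbers with $1/\sqrt2\le\alpha<3/4$ and $\frac{\sqrt{1+4\alpha}-1}{2}\le\beta\le\alpha^2$. Let $\mathcal T$ be a $\mathsf{GCB}(\alpha,\beta)$-tree whose keys belong to a linearly ordered set, and let $x$ be an element of that set. The bottom-up update that inserts $x$ in $\mathcal T$ (respectively, deletes $x$ from $\mathcal T$) can be carried out, and every tree that it may return is a $\mathsf{GCB}(\alpha,\beta)$-tree, whose keys are those of $\mathcal T$ together with $x$ (respectively, those of $\mathcal T$ other than $x$). -/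

import Mathlib

namespace GCB

universe u

variable {K : Type u}

/-! ### Weights and balances -/

/-- The two sides of a node. -/
inductive Side : Type
  | left
  | right

/-- The weight of a binary tree: its number of empty subtrees (one plus its number of nodes). -/
def weight (T : BinaryTree K) : ℝ := (T.numLeaves : ℝ)

/-- The weight of the subtree reached by following the sides in the list, starting from the root.
An empty tree, of weight `1`, is seen as an infinite complete binary tree whose nodes of
depth `d` have weight `2 ^ (-d)`. -/
noncomputable def weightAt : BinaryTree K → List Side → ℝ
  | T, [] => weight T
  | .nil, _ :: p => weightAt .nil p / 2
  | .node _ l _, Side.left :: p => weightAt l p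
  | .node _ _ r, Side.right :: p => weightAt r p

/-- Weight `|n₁|` of the left child of the root. -/
noncomputable def w1 (T : BinaryTree K) : ℝ := weightAt T [.left]
/-- Weight `|n₂|` of the right child of the root. -/
noncomputable def w2 (T : BinaryTree K) : ℝ := weightAt T [.right]
/-- Weight `|n₁₁|`. -/
noncomputable def w11 (T : BinaryTree K) : ℝ := weightAt T [.left, .left]
/-- Weight `|n₁₂|`. -/
noncomputable def w12 (T : BinaryTree K) : ℝ := weightAt T [.left, .right]
/-- Weight `|n₂₁|`. -/
noncomputable def w21 (T : BinaryTree K) : ℝ := weightAt T [.right, .left]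
/-- Weight `|n₂₂|`. -/
noncomputable def w22 (T : BinaryTree K) : ℝ := weightAt T [.right, .right]

/-- Child-balance of the root. -/
noncomputable def balC (T : BinaryTree K) : ℝ := max (w1 T) (w2 T) / weight T

/-- Grandchild-balance of the root. -/
noncomputable def balGC (T : BinaryTree K) : ℝ :=
  max (max (w11 T) (w12 T)) (max (w21 T) (w22 T)) / weight T

/-- Every node of the tree is `α`-child-balanced and `β`-grandchild-balanced. -/
def AllBalanced (α β : ℝ) : BinaryTree K → Prop
  | .nil => True
  | .node k l r =>
      balC (.node k l r) ≤ α ∧ balGC (.node k l r) ≤ β ∧ AllBalanced α β l ∧ AllBalanced α β r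

/-! ### Search trees -/

/-- The keys of a tree, listed in (symmetric) order. -/
def keys : BinaryTree K → List K
  | .nil => []
  | .node k l r => keys l ++ k :: keys r

/-- Binary search trees (without repeated keys). -/
def IsBST [LinearOrder K] : BinaryTree K → Prop
  | .nil => True
  | .node k l r => (∀ y ∈ keys l, y < k) ∧ (∀ y ∈ keys r, k < y) ∧ IsBST l ∧ IsBST r

/-- Grandchildren-balanced trees with parameters `α` and `β`: those binary search trees all of
whose nodes are `(α, β)`-balanced. -/
def IsGCBTree [LinearOrder K] (α β : ℝ) (T : BinaryTree K) : Prop :=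
  IsBST T ∧ AllBalanced α β T

/-- Perfectly balanced trees: the weights of two siblings differ by at most one. -/
def PerfectlyBalanced : BinaryTree K → Prop
  | .nil => True
  | .node _ l r =>
      l.numLeaves ≤ r.numLeaves + 1 ∧ r.numLeaves ≤ l.numLeaves + 1 ∧
        PerfectlyBalanced l ∧ PerfectlyBalanced r

/-- The key of the deepest node of the leftmost branch. -/
def leftmostKey : BinaryTree K → Option K
  | .nil => none
  | .node k .nil _ => some k
  | .node _ (.node k l r) _ => leftmostKey (.node k l r)

/-! ### Rotations

A rotation is performed at the root; the value is `none` when it cannot be performed. -/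

/-- Simple rotation: the left child becomes the root. -/
def simpleRot : BinaryTree K → Option (BinaryTree K)
  | .node n (.node n1 t11 t12) t2 => some (.node n1 t11 (.node n t12 t2))
  | _ => none

/-- Mirror image of the simple rotation. -/
def simpleRotMirror : BinaryTree K → Option (BinaryTree K)
  | .node n t1 (.node n2 t21 t22) => some (.node n2 (.node n t1 t21) t22)
  | _ => none

/-- Double rotation: the right child of the left child becomes the root. -/
def doubleRot : BinaryTree K → Option (BinaryTree K)
  | .node n (.node n1 t11 (.node n12 t121 t122)) t2 =>
      some (.node n12 (.node n1 t11 t121) (.node n t122 t2))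
  | _ => none

/-- Mirror image of the double rotation. -/
def doubleRotMirror : BinaryTree K → Option (BinaryTree K)
  | .node n t1 (.node n2 (.node n21 t211 t212) t22) =>
      some (.node n21 (.node n t1 t211) (.node n2 t212 t22))
  | _ => none

/-! ### Balancing algorithms

Each algorithm is given by its input-output relation: `A T T'` means that the algorithm `A`,
applied to `T`, may return `T'`. A case whose rotation cannot be performed returns nothing. -/

/-- The `C(u, v, w, x)`-balancing algorithm. -/
inductive CBal (u v w x : ℝ) (T : BinaryTree K) : BinaryTree K → Prop
  | case1 {T' : BinaryTree K} :
      w1 T > u * weight T + w → w11 T ≥ (1 - v) * weight T - x →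
      simpleRot T = some T' → CBal u v w x T T'
  | case2 {T' : BinaryTree K} :
      w2 T > u * weight T + w → w22 T ≥ (1 - v) * weight T - x →
      simpleRotMirror T = some T' → CBal u v w x T T'
  | case3 {T' : BinaryTree K} :
      w1 T > u * weight T + w → w11 T < (1 - v) * weight T - x →
      doubleRot T = some T' → CBal u v w x T T'
  | case4 {T' : BinaryTree K} :
      w2 T > u * weight T + w → w22 T < (1 - v) * weight T - x →
      doubleRotMirror T = some T' → CBal u v w x T T'
  | case5 :
      max (w1 T) (w2 T) ≤ u * weight T + w → CBal u v w x T T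

/-- The `GC(y, z)`-balancing algorithm. -/
inductive GCBal (y z : ℝ) (T : BinaryTree K) : BinaryTree K → Prop
  | case1 {T' : BinaryTree K} :
      w11 T > y * weight T + z → simpleRot T = some T' → GCBal y z T T'
  | case2 {T' : BinaryTree K} :
      w22 T > y * weight T + z → simpleRotMirror T = some T' → GCBal y z T T'
  | case3 {T' : BinaryTree K} :
      w12 T > y * weight T + z → doubleRot T = some T' → GCBal y z T T'
  | case4 {T' : BinaryTree K} :
      w21 T > y * weight T + z → doubleRotMirror T = some T' → GCBal y z T T'
  | case5 :
      max (max (w11 T) (w12 T)) (max (w21 T) (w22 T)) ≤ y * weight T + z → GCBal y z T T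

/-- The `CGC(u, v, y, yhat)`-balancing algorithm. -/
inductive CGCBal (u v y yhat : ℝ) (T : BinaryTree K) : BinaryTree K → Prop
  | modified {k : K} {l r l' r' T' : BinaryTree K} :
      CBal u v 0 0 T (.node k l r) → T ≠ .node k l r →
      GCBal yhat 0 l l' → GCBal yhat 0 r r' →
      GCBal yhat 0 (.node k l' r') T' → CGCBal u v y yhat T T'
  | unmodified {T' : BinaryTree K} :
      CBal u v 0 0 T T → GCBal y 0 T T' → CGCBal u v y yhat T T'

/-! ### Parameters -/

/-- The lower bound on `β`, as a function of `α`. -/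
noncomputable def scrB (α : ℝ) : ℝ := (√(1 + 4 * α) - 1) / 2

/-- The parameter called alpha-hat. -/
noncomputable def alphaHat (α : ℝ) : ℝ :=
  (1 - 2 * α + 6 * α ^ 2 - √((1 - α) * (5 - α))) / (5 * (2 * α - 1))

/-- The parameter called beta-hat. -/
noncomputable def betaHat (α β : ℝ) : ℝ :=
  (1 + α - √((1 - α) ^ 2 + 4 * α * (α ^ 2 - β))) / (2 * (1 - α ^ 2 + β)) * α

/-! ### Bottom-up updates -/

/-- Last step of an update: nothing is done if the update was redundant; otherwise, the
`CGC(α, alphaHat, β, betaHat)`-balancing algorithm is applied. -/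
def Finish (α β : ℝ) (redundant : Prop) (T T' : BinaryTree K) : Prop :=
  (redundant ∧ T' = T) ∨ (¬ redundant ∧ CGCBal α (alphaHat α) β (betaHat α β) T T')

/-- `BUInsert α β x T T'`: the bottom-up insertion of the key `x` in the tree `T` may
return `T'`. If `T` has at most 11 nodes, the result is any perfectly balanced tree with the
required keys. Otherwise, the subtree in which `x` should lie is updated first. -/
inductive BUInsert [LinearOrder K] (α β : ℝ) (x : K) : BinaryTree K → BinaryTree K → Prop
  | small {T T' : BinaryTree K} :
      T.numNodes ≤ 11 → PerfectlyBalanced T' →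
      keys T' = (if x ∈ keys T then keys T else (keys T).orderedInsert (· ≤ ·) x) →
      BUInsert α β x T T'
  | left {k : K} {l r l' T' : BinaryTree K} :
      12 ≤ (BinaryTree.node k l r).numNodes → x < k → BUInsert α β x l l' →
      Finish α β (x ∈ keys l) (.node k l' r) T' → BUInsert α β x (.node k l r) T'
  | right {k : K} {l r r' T' : BinaryTree K} :
      12 ≤ (BinaryTree.node k l r).numNodes → k < x → BUInsert α β x r r' →
      Finish α β (x ∈ keys r) (.node k l r') T' → BUInsert α β x (.node k l r) T'
  | root {l r : BinaryTree K} :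
      12 ≤ (BinaryTree.node x l r).numNodes → BUInsert α β x (.node x l r) (.node x l r)

/-- `BUDelete α β x T T'`: the bottom-up deletion of the key `x` from the tree `T` may
return `T'`. If `T` has at most 11 nodes, the result is any perfectly balanced tree with the
required keys. Otherwise, if `x` is not the key of the root, the subtree in which `x` should lie
is updated first. If `x` is the key of the root, the successor `b` of `x`, which is the
leftmost key of the right subtree, is deleted from that subtree, and `b` replaces `x`
(since rotations do not look at the keys, it does not matter whether `x` is replaced before or
after the rotations).

If `x` is the key of the root, the root has two children as soon as it has 12 nodes and is
`α`-child-balanced for some `α < 3/4`; thus, nodes with at most one child are only ever deleted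
from trees with at most 11 nodes, in the case `small`. -/
inductive BUDelete [LinearOrder K] (α β : ℝ) : K → BinaryTree K → BinaryTree K → Prop
  | small {x : K} {T T' : BinaryTree K} :
      T.numNodes ≤ 11 → PerfectlyBalanced T' → keys T' = (keys T).erase x →
      BUDelete α β x T T'
  | left {x k : K} {l r l' T' : BinaryTree K} :
      12 ≤ (BinaryTree.node k l r).numNodes → x < k → BUDelete α β x l l' →
      Finish α β (x ∉ keys l) (.node k l' r) T' → BUDelete α β x (.node k l r) T'
  | right {x k : K} {l r r' T' : BinaryTree K} :
      12 ≤ (BinaryTree.node k l r).numNodes → k < x → BUDelete α β x r r' →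
      Finish α β (x ∉ keys r) (.node k l r') T' → BUDelete α β x (.node k l r) T'
  | root {x b : K} {l r r' T' : BinaryTree K} :
      12 ≤ (BinaryTree.node x l r).numNodes → leftmostKey r = some b → BUDelete α β b r r' →
      Finish α β False (.node b l r') T' → BUDelete α β x (.node x l r) T'

end GCB

namespace GCB

universe u

variable {K : Type u}

/-! Rotations keep the ordered list of keys, so search order and keys are questions about lists; the
substance is balance. An update changes the weight of one subtree by at most 1. Hence, at a root of
updated weight `N ≥ 12` that is to be rebalanced, a child exceeds `αN` by at most `α`, so it weighs
at most `13/12 · αN`. By `CBal.balanced`, C-balancing absorbs this excess: all nodes become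
child-balanced, and only the root and its two children may fail to be grandchild-balanced.

The core is `GCBal.allBalanced`: if all strict subtrees are balanced and the root is child-balanced,
one GC-step makes the whole tree balanced, for every threshold `y` between `scrB α` and `β`. Used at
both children, which keep their weights, and then at the root, it completes the balancing step. The
inequalities behind it are `simpleRot_gc_bounds` and `doubleRot_gc_bounds`. A grandchild heavier
than `yN` makes the remaining pieces light, because `α ≤ y(1 + β)`; child-balance keeps them from
being too light; so the pieces that a rotation brings together have comparable weights. The number
`scrB α` is the root of `s + s² = α`.

A rotation that is called for can always be performed, since an empty subtree is too light to call
for it. Finally, a redundant update may still rebuild a small subtree while its ancestors are not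
rebalanced; this is harmless because a perfectly balanced tree minimizes the larger child weight
(`PerfectlyBalanced.child_le_max`). -/

/-! ### The parameters -/

/-- What the proofs use about `α`, `β` and the threshold `y` of a grandchild-balancing step. -/
structure Admissible (α β y : ℝ) : Prop where
  half_le : 1 / 2 ≤ α ^ 2
  lower : 7 / 10 ≤ α
  upper : α ≤ 3 / 4
  le_sq : β ≤ α ^ 2
  le_add_sq : α ≤ β + β ^ 2
  two_mul_le : 2 * α - 1 ≤ β
  y_le : y ≤ β
  y_lower : 47 / 100 ≤ y
  le_y : α ≤ y * (1 + β)
  key : (α - β) * (β - α * y) ≤ β ^ 2 * (1 - α) * y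

/-- What the proofs use about the parameter `v` of a child-balancing step. -/
structure AdmissibleC (α v : ℝ) : Prop where
  le : v ≤ α
  lower : (1 - v) * (1 + α) ≤ α ^ 2

theorem admissible_of_root {α β s y : ℝ} (hs0 : 0 ≤ s) (hs : s + s ^ 2 = α)
    (hα : 1 / 2 ≤ α ^ 2) (hα' : α ≤ 3 / 4) (hβ : s ≤ β) (hβ' : β ≤ α ^ 2)
    (hy : s ≤ y) (hy' : y ≤ β) : Admissible α β y := by
  have hα0 : 0 ≤ α := by nlinarith
  have hα7 : 7 / 10 ≤ α := by nlinarith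
  have hs1 : s ≤ 1 / 2 := by nlinarith
  have hs2 : 47 / 100 ≤ s := by nlinarith
  -- Since `α = s + s²`, this is `(2s - 1)(s + 1) ≤ 0`, that is, `s ≤ 1/2`, which comes from `α ≤
  -- 3/4`.
  have h2 : 2 * α - 1 ≤ s := by nlinarith
  refine ⟨hα, hα7, hα', hβ', by nlinarith, by linarith, hy', by linarith, by nlinarith, ?_⟩
  -- As `y` grows, the left side of the last field decreases and the right side increases, so `y =
  -- s` is the worst case. With `β = s + t`, right minus left is `ts(2s(1 - α) - s + (1 - α)) +
  -- t²s(1 - α) + t²`; equality holds at `t = 0`.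
  have key : (α - β) * (β - α * s) ≤ β ^ 2 * (1 - α) * s := by
    obtain ⟨t, rfl⟩ : ∃ t, β = s + t := ⟨β - s, by ring⟩
    have ht : 0 ≤ t := by linarith
    have e1 : α - (s + t) = s ^ 2 - t := by linarith
    have e2 : s + t - α * s = s * (1 - α) + t := by ring
    rw [e1, e2]
    have h3 : 0 ≤ t * s * (2 * s * (1 - α) - s + (1 - α)) := by
      have : 0 ≤ 2 * s * (1 - α) - s + (1 - α) := by nlinarith
      positivity
    have h4 : 0 ≤ t ^ 2 * s * (1 - α) := by
      have : 0 ≤ 1 - α := by linarith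
      positivity
    nlinarith [sq_nonneg t]
  have hβα : β ≤ α := by nlinarith
  have m1 : (α - β) * (β - α * y) ≤ (α - β) * (β - α * s) :=
    mul_le_mul_of_nonneg_left (by nlinarith) (by linarith)
  have m2 : β ^ 2 * (1 - α) * s ≤ β ^ 2 * (1 - α) * y :=
    mul_le_mul_of_nonneg_left hy (mul_nonneg (sq_nonneg _) (by linarith))
  linarith

theorem half_le_sq {α : ℝ} (hα : 1 / √2 ≤ α) : 0 < α ∧ 1 / 2 ≤ α ^ 2 := by
  have h2 : (0 : ℝ) < 1 / √2 := by positivity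
  have h3 : (1 / √2) ^ 2 = (1 / 2 : ℝ) := by
    rw [div_pow, Real.sq_sqrt (by norm_num)]; norm_num
  exact ⟨by linarith, by rw [← h3]; gcongr⟩

theorem scrB_spec {α : ℝ} (hα : 0 ≤ α) : 0 ≤ scrB α ∧ scrB α + scrB α ^ 2 = α := by
  have h1 : √(1 + 4 * α) ^ 2 = 1 + 4 * α := Real.sq_sqrt (by linarith)
  have h2 : 1 ≤ √(1 + 4 * α) := Real.one_le_sqrt.2 (by linarith)
  unfold scrB
  exact ⟨by linarith, by nlinarith⟩

/-- `betaHat α β` is the smaller root of `Q(y) = c y² - α(1 + α) y + α³`, where `c = 1 - α² + β`.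
Here `Q(s) = s²(β - s) ≥ 0` with `s` to the left of the vertex, and `Q(β) = -(α² - β)(β² + β - α) ≤
0`, so `β` lies between the roots. -/
theorem betaHat_bounds {α β : ℝ} (hα : 1 / 2 ≤ α ^ 2) (h0 : 0 < α) (hα' : α ≤ 3 / 4)
    (hβ : scrB α ≤ β) (hβ' : β ≤ α ^ 2) :
    scrB α ≤ betaHat α β ∧ betaHat α β ≤ β := by
  obtain ⟨hs0, hs⟩ := scrB_spec h0.le
  set s := scrB α
  have hα7 : 7 / 10 ≤ α := by nlinarith
  have hs2 : 47 / 100 ≤ s := by nlinarith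
  have hD0 : 0 ≤ (1 - α) ^ 2 + 4 * α * (α ^ 2 - β) :=
    add_nonneg (sq_nonneg _) (mul_nonneg (by linarith) (by linarith))
  have hD := Real.sq_sqrt hD0
  have hDn := Real.sqrt_nonneg ((1 - α) ^ 2 + 4 * α * (α ^ 2 - β))
  unfold betaHat
  set d := √((1 - α) ^ 2 + 4 * α * (α ^ 2 - β))
  have hc : 0 < 2 * (1 - α ^ 2 + β) := by nlinarith
  set c := 1 - α ^ 2 + β with hcdef
  have hc1 : c ≤ 1 := by linarith
  rw [div_mul_eq_mul_div]
  constructor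
  · rw [le_div_iff₀ hc]
    have hpos : 0 ≤ (1 + α) * α - s * (2 * c) := by nlinarith
    have hsq : (d * α) ^ 2 ≤ ((1 + α) * α - s * (2 * c)) ^ 2 := by
      have e : ((1 + α) * α - s * (2 * c)) ^ 2 - (d * α) ^ 2
          = 4 * c * (c * s ^ 2 - (1 + α) * α * s + α ^ 3) := by
        rw [mul_pow, hD, hcdef]; ring
      have e2 : c * s ^ 2 - (1 + α) * α * s + α ^ 3 = s ^ 2 * (β - s) := by
        rw [hcdef, ← hs]; ring
      have : 0 ≤ 4 * c * (s ^ 2 * (β - s)) := by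
        have : 0 ≤ β - s := by linarith
        have : 0 < c := by linarith
        positivity
      rw [e2] at e
      linarith
    have := (le_abs_self _).trans (abs_le_of_sq_le_sq hsq hpos)
    nlinarith [this]
  · rw [div_le_iff₀ hc]
    have hsq : ((1 + α) * α - β * (2 * c)) ^ 2 ≤ (d * α) ^ 2 := by
      have e : (d * α) ^ 2 - ((1 + α) * α - β * (2 * c)) ^ 2
          = 4 * c * ((α ^ 2 - β) * (β ^ 2 + β - α)) := by
        rw [mul_pow, hD, hcdef]; ring
      have : 0 ≤ 4 * c * ((α ^ 2 - β) * (β ^ 2 + β - α)) :=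
        mul_nonneg (by linarith) (mul_nonneg (by linarith) (by nlinarith))
      linarith
    have := (le_abs_self _).trans (abs_le_of_sq_le_sq hsq (by positivity))
    nlinarith [this]

/-- The two requirements on `v` are compatible exactly when `1 - α² ≤ α²`. For `alphaHat α`,
squaring turns each into a product with the factor `2α² - 1`; both are equalities at `α = 1/√2`. -/
theorem admissibleC_alphaHat {α : ℝ} (hα : 1 / 2 ≤ α ^ 2) (h0 : 0 < α) (hα' : α ≤ 3 / 4) :
    AdmissibleC α (alphaHat α) := by
  have hα7 : 7 / 10 ≤ α := by nlinarith
  have hD := Real.sq_sqrt (show 0 ≤ (1 - α) * (5 - α) by nlinarith)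
  have hDn := Real.sqrt_nonneg ((1 - α) * (5 - α))
  set d := √((1 - α) * (5 - α)) with hd
  have hc : 0 < 5 * (2 * α - 1) := by linarith
  have hv : alphaHat α * (5 * (2 * α - 1)) = 1 - 2 * α + 6 * α ^ 2 - d := by
    unfold alphaHat; rw [← hd, div_mul_cancel₀ _ hc.ne']
  constructor
  · refine le_of_mul_le_mul_right ?_ hc
    rw [hv]
    have hsq : ((1 - α) * (1 + 4 * α)) ^ 2 ≤ d ^ 2 := by
      have e : d ^ 2 - ((1 - α) * (1 + 4 * α)) ^ 2
          = 4 * (1 - α) * ((2 * α - 1) * (2 * α ^ 2 - 1)) := by rw [hD]; ring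
      have : 0 ≤ 4 * (1 - α) * ((2 * α - 1) * (2 * α ^ 2 - 1)) :=
        mul_nonneg (by linarith) (mul_nonneg (by linarith) (by linarith))
      linarith
    have := (le_abs_self _).trans (abs_le_of_sq_le_sq hsq hDn)
    nlinarith [this]
  · refine le_of_mul_le_mul_right ?_ hc
    have e : (1 - alphaHat α) * (1 + α) * (5 * (2 * α - 1))
        = (1 + α) * (5 * (2 * α - 1) - alphaHat α * (5 * (2 * α - 1))) := by ring
    rw [e, hv]
    have hp : 0 ≤ 16 * α ^ 3 - 11 * α ^ 2 - 6 * α + 6 := by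
      nlinarith [mul_nonneg h0.le (sq_nonneg (α - 7 / 10))]
    have hsq : (d * (1 + α)) ^ 2 ≤ (16 * α ^ 3 - 11 * α ^ 2 - 6 * α + 6) ^ 2 := by
      have e : (16 * α ^ 3 - 11 * α ^ 2 - 6 * α + 6) ^ 2 - (d * (1 + α)) ^ 2
          = (2 * α ^ 2 - 1) * (2 * α - 1) * (64 * α ^ 3 - 56 * α ^ 2 - 14 * α + 31) := by
        rw [mul_pow, hD]; ring
      have : 0 ≤ (2 * α ^ 2 - 1) * (2 * α - 1) * (64 * α ^ 3 - 56 * α ^ 2 - 14 * α + 31) := by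
        refine mul_nonneg (mul_nonneg (by linarith) (by linarith)) ?_
        nlinarith [mul_nonneg h0.le (sq_nonneg (α - 7 / 10))]
      linarith
    have := (le_abs_self _).trans (abs_le_of_sq_le_sq hsq hp)
    nlinarith [this]

/-! ### Inequalities between weights

In a simple rotation, the weights of `n₁₁`, `n₁₂`, `n₂` are `A`, `B`, `C`. In a double rotation,
those of `n₁₁`, `n₁₂₁`, `n₁₂₂`, `n₂` are `A`, `D`, `E`, `C`. -/

/-- With `p = A + B` and `N = p + C`, the hypotheses give `αN ≤ (1 + β)A`, whence `B ≤ βA` and `C ≤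
βp`; child-balance gives `B ≥ (1 - α)p` and `C ≥ (1 - α)N`. The last two conclusions handle the
children of `n₁₂` and `n₂`, which weigh at most `αB` and `αC`; they use `α - β ≤ 1 - α`. -/
theorem simpleRot_gc_bounds {α β y A B C : ℝ} (P : Admissible α β y)
    (hA : 0 ≤ A) (hB : 0 ≤ B) (hC : 0 ≤ C)
    (hA1 : A ≤ α * (A + B)) (hroot : A + B ≤ α * (A + B + C))
    (hy : y * (A + B + C) < A) :
    (A ≤ α * (A + B + C) ∧ B + C ≤ α * (A + B + C) ∧
      B ≤ β * (A + B + C) ∧ C ≤ β * (A + B + C)) ∧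
    (B ≤ α * (B + C) ∧ C ≤ α * (B + C)) ∧ α * B ≤ β * (B + C) ∧ α * C ≤ β * (B + C) := by
  obtain ⟨h1, h2, h3, h4, h5, h6, h7, h8, h9, -⟩ := P
  obtain ⟨N, hN⟩ : ∃ N, N = A + B + C := ⟨_, rfl⟩
  obtain ⟨p, hp⟩ : ∃ p, p = A + B := ⟨_, rfl⟩
  have eB : B = p - A := by linarith
  have eC : C = N - p := by linarith
  rw [← hN] at hroot hy ⊢
  rw [← hp] at hA1 hroot
  have hN0 : 0 ≤ N := by linarith
  have hp0 : 0 ≤ p := by linarith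
  have hα0 : 0 < α := by linarith
  have hβ0 : 0 < β := by linarith
  have hα1 : 0 ≤ 1 - α := by linarith
  have hαβ : 0 ≤ α - β := by nlinarith
  have hyN : α * N ≤ y * (1 + β) * N := mul_le_mul_of_nonneg_right h9 hN0
  have hAy : α * N ≤ (1 + β) * A := by
    linarith [mul_le_mul_of_nonneg_left hy.le (show 0 ≤ 1 + β by linarith)]
  have hpN : N ≤ (1 + β) * p := by
    have : α * N ≤ α * ((1 + β) * p) := by
      linarith [mul_le_mul_of_nonneg_left hA1 (show 0 ≤ 1 + β by linarith)]
    exact le_of_mul_le_mul_left this hα0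
  have hBα : (1 - α) * p ≤ B := by linarith
  have hBβ : B ≤ β * A := by linarith
  have hCβ : C ≤ β * p := by linarith
  have hCα : (1 - α) * N ≤ C := by linarith
  have hAN : β * A ≤ β * N := mul_le_mul_of_nonneg_left (by linarith) hβ0.le
  have hpN' : β * p ≤ β * N := mul_le_mul_of_nonneg_left (by linarith) hβ0.le
  have hαβN : 0 ≤ (α - β) * N := mul_nonneg hαβ hN0
  have hαβp : 0 ≤ (α - β) * p := mul_nonneg hαβ hp0
  refine ⟨⟨by linarith, ?_, by linarith, by linarith⟩, ⟨?_, ?_⟩, ?_, ?_⟩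
  · linarith [mul_nonneg (show 0 ≤ y - (1 - α) by linarith) hN0]
  · linarith [mul_nonneg hα1 (show 0 ≤ α * N - B by linarith),
      mul_nonneg hα0.le (sub_nonneg.2 hCα)]
  · linarith [mul_nonneg hα1 (show 0 ≤ α * p - C by linarith),
      mul_nonneg hα0.le (sub_nonneg.2 hBα)]
  · linarith [mul_nonneg (show 0 ≤ (1 - α) - (α - β) by linarith) hB,
      mul_nonneg hα1 (show 0 ≤ β * N - B by linarith), mul_nonneg hβ0.le (sub_nonneg.2 hCα)]
  · linarith [mul_nonneg (show 0 ≤ (1 - α) - (α - β) by linarith) hC,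
      mul_nonneg hα1 (show 0 ≤ β * p - C by linarith), mul_nonneg hβ0.le (sub_nonneg.2 hBα)]

/-- A child, of weight `d`, of `n₁₂₁` or `n₁₂₂`, of weight `D`, whose new sibling has
weight `A`; the weight of `n₁₂` is `q`. -/
theorem grandchild_bound {α β q A D d : ℝ} (hα : 0 < α) (hβ : 0 ≤ β) (h2 : 2 * α - 1 ≤ β)
    (hα1 : α ≤ 1) (hd : 0 ≤ d) (hA : (1 - α) * q ≤ α * A) (hD : d ≤ α * D) (hq : d ≤ β * q) :
    d ≤ β * (A + D) := by
  -- Split `α` as `(1 - α) + (2α - 1)`: `αβA ≥ β(1 - α)q ≥ (1 - α)d`, and `αβD ≥ βd ≥ (2α - 1)d`.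
  have h : α * d ≤ α * (β * (A + D)) := by
    linarith [mul_nonneg hβ (sub_nonneg.2 hA), mul_nonneg hβ (sub_nonneg.2 hD),
      mul_nonneg (sub_nonneg.2 hα1) (sub_nonneg.2 hq), mul_nonneg (sub_nonneg.2 h2) hd]
  exact le_of_mul_le_mul_left h hα

/-- Here it is `q = D + E` that exceeds `yN`, which yields `A ≤ βq` and `C ≤ βp`. The bounds on `αA`
and `αC` handle the children of `n₁₁` and `n₂`; the last two conclusions feed `grandchild_bound`,
for the children of `n₁₂₁` and `n₁₂₂`. -/
theorem doubleRot_gc_bounds {α β y A D E C : ℝ} (P : Admissible α β y)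
    (hA : 0 ≤ A) (hD : 0 ≤ D) (hE : 0 ≤ E) (hC : 0 ≤ C)
    (hB1 : D + E ≤ α * (A + (D + E))) (hDB : D ≤ α * (D + E)) (hEB : E ≤ α * (D + E))
    (hDβ : D ≤ β * (A + (D + E))) (hEβ : E ≤ β * (A + (D + E)))
    (hroot : A + (D + E) ≤ α * (A + (D + E) + C))
    (hy : y * (A + (D + E) + C) < D + E) :
    (A + D ≤ α * (A + (D + E) + C) ∧ E + C ≤ α * (A + (D + E) + C) ∧
      A ≤ β * (A + (D + E) + C) ∧ D ≤ β * (A + (D + E) + C) ∧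
      E ≤ β * (A + (D + E) + C) ∧ C ≤ β * (A + (D + E) + C)) ∧
    (A ≤ α * (A + D) ∧ D ≤ α * (A + D) ∧ E ≤ α * (E + C) ∧ C ≤ α * (E + C)) ∧
    (α * A ≤ β * (A + D) ∧ α * C ≤ β * (E + C)) ∧
    (1 - α) * (D + E) ≤ α * A ∧ (1 - α) * (D + E) ≤ α * C := by
  obtain ⟨h1, h2, h3, h4, h5, h6, h7, h8, h9, hkey⟩ := P
  obtain ⟨N, hN⟩ : ∃ N, N = A + (D + E) + C := ⟨_, rfl⟩
  obtain ⟨p, hp⟩ : ∃ p, p = A + (D + E) := ⟨_, rfl⟩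
  obtain ⟨q, hq⟩ : ∃ q, q = D + E := ⟨_, rfl⟩
  have eA : A = p - q := by linarith
  have eC : C = N - p := by linarith
  rw [← hN] at hroot hy ⊢
  rw [← hp] at hB1 hDβ hEβ hroot
  rw [← hq] at hB1 hDB hEB hy ⊢
  have hN0 : 0 ≤ N := by linarith
  have hp0 : 0 ≤ p := by linarith
  have hq0 : 0 ≤ q := by linarith
  have hα0 : 0 < α := by linarith
  have hβ0 : 0 < β := by linarith
  have hα1 : 0 ≤ 1 - α := by linarith
  have hαβ : 0 ≤ α - β := by nlinarith
  have hβ3 : 0 ≤ (1 - α) - (α - β) := by linarith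
  have hβ1 : 0 ≤ 1 + β := by linarith
  have hyN : α * N ≤ y * (1 + β) * N := mul_le_mul_of_nonneg_right h9 hN0
  have hqN : α * N ≤ (1 + β) * q := by
    linarith [mul_le_mul_of_nonneg_left hy.le hβ1]
  have hpN : N ≤ (1 + β) * p := by
    have : α * N ≤ α * ((1 + β) * p) := by
      linarith [mul_le_mul_of_nonneg_left hB1 hβ1]
    exact le_of_mul_le_mul_left this hα0
  have hDq : (1 - α) * q ≤ D := by linarith
  have hEq : (1 - α) * q ≤ E := by linarith
  have hAβ : A ≤ β * q := by linarith
  have hCβ : C ≤ β * p := by linarith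
  have hαβq : 0 ≤ (α - β) * q := mul_nonneg hαβ hq0
  have hpqN : N ≤ p + q := by
    have : α * N ≤ α * (p + q) := by linarith
    exact le_of_mul_le_mul_left this hα0
  have hAq : (1 - α) * q ≤ α * A := by rw [eA]; linarith
  have hCN : (1 - α) * N ≤ C := by linarith
  have hqαN : q ≤ α * N := by linarith
  have hCq : (1 - α) * q ≤ α * C := by
    linarith [mul_nonneg hα0.le (sub_nonneg.2 hCN), mul_nonneg hα1 (sub_nonneg.2 hqαN)]
  have hpA : (1 - α) * p ≤ A := by linarith
  -- From `αN ≤ (1 + β)q` and `q ≤ αp`, one gets `αC ≤ βq`; this is where `β ≤ α²` matters.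
  have hCq' : C ≤ α * q := by
    have : α * C ≤ α * (α * q) := by
      rw [eC]; linarith [mul_nonneg (sub_nonneg.2 h4) hq0]
    exact le_of_mul_le_mul_left this hα0
  have hβp : β * p ≤ β * N := mul_le_mul_of_nonneg_left (by linarith) hβ0.le
  have hβq : β * q ≤ β * p := mul_le_mul_of_nonneg_left (by linarith) hβ0.le
  have hαD := mul_nonneg hα0.le (sub_nonneg.2 hDq)
  have hαE := mul_nonneg hα0.le (sub_nonneg.2 hEq)
  refine ⟨⟨by linarith, ?_, by linarith, by linarith, by linarith, by linarith⟩,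
    ⟨?_, ?_, ?_, ?_⟩, ⟨?_, ?_⟩, hAq, hCq⟩
  · linarith [mul_nonneg hα1 (sub_nonneg.2 hpqN)]
  · linarith [mul_nonneg hα1 (show 0 ≤ α * q - A by linarith)]
  · linarith [mul_nonneg hα1 (show 0 ≤ q - D by linarith)]
  · linarith [mul_nonneg hα1 (show 0 ≤ q - E by linarith)]
  · linarith [mul_nonneg hα1 (sub_nonneg.2 hCq')]
  · linarith [mul_nonneg hβ3 hA, mul_nonneg hα1 (sub_nonneg.2 hAβ),
      mul_nonneg hβ0.le (sub_nonneg.2 hDq)]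
  · have : y * ((α - β) * C) ≤ y * (β * E) := by
      have e1 : y * ((α - β) * C) ≤ (α - β) * (q - y * p) := by
        have : y * C ≤ q - y * p := by rw [eC]; linarith
        have := mul_le_mul_of_nonneg_left this hαβ
        linarith
      have hk : (α - β) * (β - α * y) * q ≤ β ^ 2 * (1 - α) * y * q :=
        mul_le_mul_of_nonneg_right hkey hq0
      have hy0 : 0 ≤ y := by linarith
      refine e1.trans ?_
      refine le_of_mul_le_mul_left ?_ hβ0
      -- `D ≤ αq` and `D ≤ βp` give two lower bounds for `E`, namely `(1 - α)q` and `q - βp`, which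
      -- agree when `αq = βp`. In either case the inequality is linear in `p` and worst at this
      -- crossover (on the second side because `α ≤ β + β²`), where it becomes `hkey` multiplied by
      -- `q`.
      rcases le_total (α * q) (β * p) with h | h
      · have m1 : y * (α - β) * (α * q) ≤ y * (α - β) * (β * p) :=
          mul_le_mul_of_nonneg_left h (mul_nonneg hy0 hαβ)
        have m2 : β ^ 2 * y * ((1 - α) * q) ≤ β ^ 2 * y * E :=
          mul_le_mul_of_nonneg_left hEq (by positivity)
        linarith
      · have hE' : q - β * p ≤ E := by linarith
        have m1 : y * (β + β ^ 2 - α) * (β * p) ≤ y * (β + β ^ 2 - α) * (α * q) :=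
          mul_le_mul_of_nonneg_left h (mul_nonneg hy0 (by linarith))
        have m2 : β ^ 2 * y * (q - β * p) ≤ β ^ 2 * y * E :=
          mul_le_mul_of_nonneg_left hE' (by positivity)
        linarith
    have := le_of_mul_le_mul_left this (by linarith)
    linarith

/-- The root exceeds its bound by the slack `α` left by an update, and `N ≥ 12` turns this into `p ≤
13/12 · αN`. The condition `v ≤ α` ensures that the piece lifted by the rotation weighs at least `(1
- α)N`. -/
theorem simpleRot_c_bounds {α v A B C : ℝ} (hα : 7 / 10 ≤ α) (hα' : α ≤ 3 / 4) (hv : v ≤ α)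
    (hC : 0 ≤ C) (hA1 : A ≤ α * (A + B))
    (hroot : α * (A + B + C) < A + B) (hroot' : A + B ≤ α * (A + B + C) + α)
    (hN : 12 ≤ A + B + C) (hA : (1 - v) * (A + B + C) ≤ A) :
    (A ≤ α * (A + B + C) ∧ B + C ≤ α * (A + B + C)) ∧
      B ≤ α * (B + C) ∧ C ≤ α * (B + C) := by
  obtain ⟨N, hNe⟩ : ∃ N, N = A + B + C := ⟨_, rfl⟩
  obtain ⟨p, hp⟩ : ∃ p, p = A + B := ⟨_, rfl⟩
  have eB : B = p - A := by linarith
  have eC : C = N - p := by linarith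
  rw [← hNe] at hroot hroot' hN hA ⊢
  rw [← hp] at hA1 hroot hroot'
  have hα0 : 0 ≤ α := le_trans (by norm_num) hα
  have hα1 : 0 ≤ 1 - α := by linarith
  have hp' : p ≤ 13 / 12 * (α * N) := by linarith [mul_nonneg hα0 (sub_nonneg.2 hN)]
  have hA' : (1 - α) * N ≤ A := by
    linarith [mul_nonneg (sub_nonneg.2 hv) (show 0 ≤ N by linarith)]
  have hBp : (1 - α) * p ≤ B := by linarith
  refine ⟨⟨?_, by linarith⟩, ?_, ?_⟩
  · linarith [mul_nonneg hα0 (show 0 ≤ N - p by linarith)]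
  · have : (1 - α) * B ≤ α * C := by
      have e : α * C - (1 - α) * B = α * N - p + (1 - α) * A := by rw [eB, eC]; ring
      have : 0 ≤ (1 - α) * (A - (1 - α) * N) := mul_nonneg hα1 (by linarith)
      -- Equality holds at `α = 3/4`: this is where the constants 12 and 3/4 fit together exactly.
      have : 0 ≤ N * ((1 - α) ^ 2 - 1 / 12 * α) := mul_nonneg (by linarith) (by nlinarith)
      linarith
    linarith
  · have : C ≤ α * p := by
      linarith [mul_nonneg (show 0 ≤ 1 + α by linarith) (sub_nonneg.2 hroot.le),
        mul_nonneg (show 0 ≤ α ^ 2 + α - 1 by nlinarith) (show 0 ≤ N by linarith)]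
    linarith [mul_nonneg hα1 (sub_nonneg.2 this), mul_nonneg hα0 (sub_nonneg.2 hBp)]

/-- The choice of `v` gives `(1 + α)A ≤ α²N < αp`, which is what `A ≤ αq` requires. The bound `C ≤
αq` then comes down to `2α² ≥ 1`. -/
theorem doubleRot_c_bounds {α v A D E C : ℝ} (hα : 7 / 10 ≤ α) (hα2 : 1 / 2 ≤ α ^ 2)
    (hα' : α ≤ 3 / 4) (hv : (1 - v) * (1 + α) ≤ α ^ 2)
    (hA : 0 ≤ A) (hD : 0 ≤ D) (hE : 0 ≤ E)
    (hA1 : A ≤ α * (A + (D + E))) (hB1 : D + E ≤ α * (A + (D + E)))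
    (hDB : D ≤ α * (D + E)) (hEB : E ≤ α * (D + E))
    (hroot : α * (A + (D + E) + C) < A + (D + E))
    (hroot' : A + (D + E) ≤ α * (A + (D + E) + C) + α)
    (hN : 12 ≤ A + (D + E) + C) (hAv : A < (1 - v) * (A + (D + E) + C)) :
    (A + D ≤ α * (A + (D + E) + C) ∧ E + C ≤ α * (A + (D + E) + C)) ∧
    (A ≤ α * (A + D) ∧ D ≤ α * (A + D)) ∧ E ≤ α * (E + C) ∧ C ≤ α * (E + C) := by
  obtain ⟨N, hNe⟩ : ∃ N, N = A + (D + E) + C := ⟨_, rfl⟩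
  obtain ⟨p, hp⟩ : ∃ p, p = A + (D + E) := ⟨_, rfl⟩
  obtain ⟨q, hq⟩ : ∃ q, q = D + E := ⟨_, rfl⟩
  have eA : A = p - q := by linarith
  have eC : C = N - p := by linarith
  rw [← hNe] at hroot hroot' hN hAv ⊢
  rw [← hp] at hA1 hB1 hroot hroot'
  rw [← hq] at hB1 hDB hEB
  have hN0 : 0 ≤ N := by linarith
  have hα0 : 0 ≤ α := by linarith
  have hα1 : 0 ≤ 1 - α := by linarith
  have hα3 : 0 < 1 + α := by linarith
  have hp' : p ≤ 13 / 12 * (α * N) := by linarith [mul_nonneg hα0 (sub_nonneg.2 hN)]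
  have hAα : (1 + α) * A ≤ α ^ 2 * N := by
    linarith [mul_le_mul_of_nonneg_left hAv.le hα3.le, mul_le_mul_of_nonneg_right hv hN0]
  have hAp : (1 - α) * p ≤ A := by linarith
  have hDq : (1 - α) * q ≤ D := by linarith
  have hEq : (1 - α) * q ≤ E := by linarith
  have hq0 : 0 ≤ q := by linarith
  have hAq : A ≤ α * q := by
    have : α * (α * N) ≤ α * p := mul_le_mul_of_nonneg_left hroot.le hα0
    have : (1 + α) * A ≤ α * p := by linarith
    rw [hp, ← hq] at this
    linarith
  have hCq : C ≤ α * q := by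
    have h : (1 + α) * C ≤ (1 + α) * (α * q) := by
      have e : (1 + α) * (α * q) - (1 + α) * C
          = (1 + α) ^ 2 * p - α * ((1 + α) * A) - (1 + α) * N := by rw [eC, eA]; ring
      have m1 : (1 + α) ^ 2 * (α * N) ≤ (1 + α) ^ 2 * p :=
        mul_le_mul_of_nonneg_left hroot.le (by positivity)
      have m2 : α * ((1 + α) * A) ≤ α * (α ^ 2 * N) := mul_le_mul_of_nonneg_left hAα hα0
      have m3 : 0 ≤ N * (2 * α ^ 2 - 1) := mul_nonneg hN0 (by linarith)
      linarith
    exact le_of_mul_le_mul_left h hα3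
  have hpq : N ≤ p + q := by
    have h : (1 + α) * N ≤ (1 + α) * (p + q) := by
      have e : (1 + α) * (p + q) = 2 * (1 + α) * p - (1 + α) * A := by rw [eA]; ring
      have m1 := mul_le_mul_of_nonneg_left hroot.le hα3.le
      have m2 : 0 ≤ N * (α ^ 2 + α - 1) := mul_nonneg hN0 (by linarith)
      linarith
    exact le_of_mul_le_mul_left h hα3
  have hAD : A + D ≤ α * N := by
    have h : (1 + α) * (A + D) ≤ (1 + α) * (α * N) := by
      have h1 : A + D ≤ α * p + (1 - α) * A := by
        rw [hp, ← hq]; linarith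
      have h2 : (1 - α) * ((1 + α) * A) ≤ (1 - α) * (α ^ 2 * N) :=
        mul_le_mul_of_nonneg_left hAα hα1
      have h3 : (1 + α) * (A + D) ≤ (1 + α) * (α * p + (1 - α) * A) :=
        mul_le_mul_of_nonneg_left h1 hα3.le
      have h4 : (1 + α) * α * p ≤ (1 + α) * α * (13 / 12 * (α * N)) :=
        mul_le_mul_of_nonneg_left hp' (by positivity)
      have h5 : 0 ≤ N * α * ((1 + α) - 13 / 12 * (α * (1 + α)) - (1 - α) * α) :=
        mul_nonneg (by positivity) (by nlinarith)
      linarith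
    exact le_of_mul_le_mul_left h hα3
  have hαD := mul_nonneg hα0 (sub_nonneg.2 hDq)
  have hαE := mul_nonneg hα0 (sub_nonneg.2 hEq)
  refine ⟨⟨hAD, ?_⟩, ⟨?_, ?_⟩, ?_, ?_⟩
  · linarith [mul_nonneg hα1 (sub_nonneg.2 hpq)]
  · linarith [mul_nonneg hα1 (sub_nonneg.2 hAq)]
  · have : (1 - α) * q ≤ A := by
      linarith [mul_nonneg hα1 (show 0 ≤ p - q by linarith)]
    linarith [mul_nonneg hα1 (sub_nonneg.2 hDB), mul_nonneg hα0 (sub_nonneg.2 this)]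
  · have : (1 - α) * q ≤ C := by
      have : (1 - α) * q ≤ (1 - α) * (α * p) := mul_le_mul_of_nonneg_left hB1 hα1
      have : (1 - α) * α * p ≤ (1 - α) * α * (13 / 12 * (α * N)) :=
        mul_le_mul_of_nonneg_left hp' (by positivity)
      have : 0 ≤ N * (1 - 13 / 12 * α - (1 - α) * α * (13 / 12 * α)) :=
        mul_nonneg hN0 (by nlinarith)
      linarith
    linarith [mul_nonneg hα1 (sub_nonneg.2 hEB), mul_nonneg hα0 (sub_nonneg.2 this)]
  · linarith [mul_nonneg hα1 (sub_nonneg.2 hCq)]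

/-! ### Weights and balance -/

@[simp] theorem weight_nil : weight (.nil : BinaryTree K) = 1 := by simp [weight]

@[simp] theorem weight_node (k : K) (l r : BinaryTree K) :
    weight (.node k l r) = weight l + weight r := by simp [weight]

@[simp] theorem w1_nil : w1 (.nil : BinaryTree K) = 1 / 2 := by simp [w1, weightAt]
@[simp] theorem w2_nil : w2 (.nil : BinaryTree K) = 1 / 2 := by simp [w2, weightAt]
@[simp] theorem w11_nil : w11 (.nil : BinaryTree K) = 1 / 4 := by norm_num [w11, weightAt]
@[simp] theorem w12_nil : w12 (.nil : BinaryTree K) = 1 / 4 := by norm_num [w12, weightAt]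
@[simp] theorem w21_nil : w21 (.nil : BinaryTree K) = 1 / 4 := by norm_num [w21, weightAt]
@[simp] theorem w22_nil : w22 (.nil : BinaryTree K) = 1 / 4 := by norm_num [w22, weightAt]

section node

variable (k : K) (l r : BinaryTree K)

@[simp] theorem w1_node : w1 (.node k l r) = weight l := by simp [w1, weightAt]
@[simp] theorem w2_node : w2 (.node k l r) = weight r := by simp [w2, weightAt]
@[simp] theorem w11_node : w11 (.node k l r) = w1 l := rfl
@[simp] theorem w12_node : w12 (.node k l r) = w2 l := rfl
@[simp] theorem w21_node : w21 (.node k l r) = w1 r := rfl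
@[simp] theorem w22_node : w22 (.node k l r) = w2 r := rfl

end node

theorem one_le_weight (T : BinaryTree K) : 1 ≤ weight T := by
  have := T.numLeaves_pos
  unfold weight
  exact_mod_cast this

theorem weight_nonneg (T : BinaryTree K) : 0 ≤ weight T := zero_le_one.trans (one_le_weight T)

theorem w1_nonneg (T : BinaryTree K) : 0 ≤ w1 T := by
  cases T <;> simp [weight_nonneg]

theorem w2_nonneg (T : BinaryTree K) : 0 ≤ w2 T := by
  cases T <;> simp [weight_nonneg]

theorem length_keys (T : BinaryTree K) : (keys T).length + 1 = T.numLeaves := by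
  induction T with
  | nil => rfl
  | node k l r hl hr => simp [keys]; omega

theorem weight_eq_of_keys_eq {T T' : BinaryTree K} (h : keys T' = keys T) :
    weight T' = weight T := by
  unfold weight
  rw [← length_keys, ← length_keys, h]

/-- All strict subtrees are balanced, and so is the root, except possibly for its
grandchildren. -/
def PreBalanced (α β : ℝ) : BinaryTree K → Prop
  | .nil => True
  | .node _ l r =>
      (weight l ≤ α * (weight l + weight r) ∧ weight r ≤ α * (weight l + weight r)) ∧
        AllBalanced α β l ∧ AllBalanced α β r

/-- Clears denominators and isolates the grandchild condition at the root, the only one that a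
GC-step has to restore. -/
theorem allBalanced_node {α β : ℝ} {k : K} {l r : BinaryTree K} :
    AllBalanced α β (.node k l r) ↔ PreBalanced α β (.node k l r) ∧
      (w1 l ≤ β * (weight l + weight r) ∧ w2 l ≤ β * (weight l + weight r)) ∧
      w1 r ≤ β * (weight l + weight r) ∧ w2 r ≤ β * (weight l + weight r) := by
  have h : 0 < weight l + weight r := by
    linarith [one_le_weight l, one_le_weight r]
  simp only [AllBalanced, PreBalanced, balC, balGC, weight_node, w1_node, w2_node, w11_node,
    w12_node, w21_node, w22_node, div_le_iff₀ h, max_le_iff]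
  tauto

theorem AllBalanced.preBalanced {α β : ℝ} {T : BinaryTree K} (h : AllBalanced α β T) :
    PreBalanced α β T := by
  cases T with
  | nil => trivial
  | node k l r => exact (allBalanced_node.1 h).1

/-- Covers the empty tree too, whose fictitious children weigh `1/2`; rotations thus need no
separate treatment of empty pieces. -/
theorem AllBalanced.child_le {α β : ℝ} (hα : 1 / 2 ≤ α) {T : BinaryTree K}
    (h : AllBalanced α β T) : w1 T ≤ α * weight T ∧ w2 T ≤ α * weight T := by
  cases T with
  | nil => simp only [w1_nil, w2_nil, weight_nil]; constructor <;> linarith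
  | node k l r => simpa using (allBalanced_node.1 h).1.1

/-! ### Grandchild-balancing -/

theorem keys_simpleRot {T T' : BinaryTree K} (h : simpleRot T = some T') : keys T' = keys T := by
  rcases T with _ | ⟨n, _ | ⟨n1, t11, t12⟩, t2⟩ <;> simp [simpleRot] at h
  subst h; simp [keys]

theorem keys_simpleRotMirror {T T' : BinaryTree K} (h : simpleRotMirror T = some T') :
    keys T' = keys T := by
  rcases T with _ | ⟨n, t1, _ | ⟨n2, t21, t22⟩⟩ <;> simp [simpleRotMirror] at h
  subst h; simp [keys]

theorem keys_doubleRot {T T' : BinaryTree K} (h : doubleRot T = some T') : keys T' = keys T := by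
  rcases T with _ | ⟨n, _ | ⟨n1, t11, _ | ⟨n12, t121, t122⟩⟩, t2⟩ <;> simp [doubleRot] at h
  subst h; simp [keys]

theorem keys_doubleRotMirror {T T' : BinaryTree K} (h : doubleRotMirror T = some T') :
    keys T' = keys T := by
  rcases T with _ | ⟨n, t1, _ | ⟨n2, _ | ⟨n21, t211, t212⟩, t22⟩⟩ <;>
    simp [doubleRotMirror] at h
  subst h; simp [keys]

theorem GCBal.keys_eq {y z : ℝ} {T T' : BinaryTree K} (h : GCBal y z T T') :
    keys T' = keys T := by
  cases h with
  | case1 _ h => exact keys_simpleRot h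
  | case2 _ h => exact keys_simpleRotMirror h
  | case3 _ h => exact keys_doubleRot h
  | case4 _ h => exact keys_doubleRotMirror h
  | case5 => rfl

theorem CBal.keys_eq {u v w x : ℝ} {T T' : BinaryTree K} (h : CBal u v w x T T') :
    keys T' = keys T := by
  cases h with
  | case1 _ _ h => exact keys_simpleRot h
  | case2 _ _ h => exact keys_simpleRotMirror h
  | case3 _ _ h => exact keys_doubleRot h
  | case4 _ _ h => exact keys_doubleRotMirror h
  | case5 => rfl

theorem CGCBal.keys_eq {u v y z : ℝ} {T T' : BinaryTree K} (h : CGCBal u v y z T T') :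
    keys T' = keys T := by
  cases h with
  | modified h _ hl hr h' =>
    rw [h'.keys_eq, ← h.keys_eq]
    simp [keys, hl.keys_eq, hr.keys_eq]
  | unmodified _ h => exact h.keys_eq

/-- Several cases may apply at once, and a rotation may be triggered by a grandchild of weight
between `yN` and `βN`; every permitted choice works. When nothing is done, `y ≤ β` suffices. Mirror
cases use the same inequalities with left and right exchanged. -/
theorem GCBal.allBalanced {α β y : ℝ} (P : Admissible α β y) {T T' : BinaryTree K}
    (hT : PreBalanced α β T) (h : GCBal y 0 T T') : AllBalanced α β T' := by
  have hα : 1 / 2 ≤ α := by linarith [P.lower]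
  have hα0 : 0 < α := by linarith
  have hα1 : α ≤ 1 := by linarith [P.upper]
  have hβ0 : 0 ≤ β := by linarith [P.y_le, P.y_lower]
  cases h with
  | case1 hy h =>
    rcases T with _ | ⟨n, _ | ⟨n1, t11, t12⟩, t2⟩ <;> simp [simpleRot] at h
    subst h
    obtain ⟨⟨hr1, hr2⟩, h1, h2⟩ := hT
    obtain ⟨⟨⟨h11, h12⟩, b11, b12⟩, ⟨g1, g2⟩, g3, g4⟩ := allBalanced_node.1 h1
    simp only [w11_node, w1_node, weight_node, add_zero] at *
    obtain ⟨⟨e1, e2, e3, e4⟩, ⟨e5, e6⟩, e7, e8⟩ := simpleRot_gc_bounds P (weight_nonneg t11)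
      (weight_nonneg t12) (weight_nonneg t2) h11 hr1 hy
    obtain ⟨c1, c2⟩ := b12.child_le hα
    obtain ⟨c3, c4⟩ := h2.child_le hα
    have hβ := mul_nonneg hβ0 (weight_nonneg t2)
    refine allBalanced_node.2 ⟨⟨?_, b11, allBalanced_node.2 ⟨⟨⟨e5, e6⟩, b12, h2⟩, ?_⟩⟩, ?_⟩
    all_goals try simp only [w1_node, w2_node, weight_node]
    · constructor <;> linarith
    · refine ⟨⟨?_, ?_⟩, ?_, ?_⟩ <;> linarith
    · refine ⟨⟨?_, ?_⟩, ?_, ?_⟩ <;> linarith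
  | case2 hy h =>
    rcases T with _ | ⟨n, t1, _ | ⟨n2, t21, t22⟩⟩ <;> simp [simpleRotMirror] at h
    subst h
    obtain ⟨⟨hr1, hr2⟩, h1, h2⟩ := hT
    obtain ⟨⟨⟨h11, h12⟩, b11, b12⟩, ⟨g1, g2⟩, g3, g4⟩ := allBalanced_node.1 h2
    simp only [w22_node, w2_node, weight_node, add_zero] at *
    obtain ⟨⟨e1, e2, e3, e4⟩, ⟨e5, e6⟩, e7, e8⟩ := simpleRot_gc_bounds P (weight_nonneg t22)
      (weight_nonneg t21) (weight_nonneg t1) (by linarith) (by linarith) (by linarith)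
    obtain ⟨c1, c2⟩ := b11.child_le hα
    obtain ⟨c3, c4⟩ := h1.child_le hα
    have hβ := mul_nonneg hβ0 (weight_nonneg t1)
    refine allBalanced_node.2 ⟨⟨?_, allBalanced_node.2 ⟨⟨?_, h1, b11⟩, ?_⟩, b12⟩, ?_⟩
    all_goals try simp only [w1_node, w2_node, weight_node]
    · constructor <;> linarith
    · constructor <;> linarith
    · refine ⟨⟨?_, ?_⟩, ?_, ?_⟩ <;> linarith
    · refine ⟨⟨?_, ?_⟩, ?_, ?_⟩ <;> linarith
  | case3 hy h =>
    rcases T with _ | ⟨n, _ | ⟨n1, t11, _ | ⟨n12, t121, t122⟩⟩, t2⟩ <;> simp [doubleRot] at h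
    subst h
    obtain ⟨⟨hr1, hr2⟩, h1, h2⟩ := hT
    obtain ⟨⟨⟨h11, h12⟩, b11, b12⟩, ⟨g1, g2⟩, g3, g4⟩ := allBalanced_node.1 h1
    obtain ⟨⟨⟨h121, h122⟩, b121, b122⟩, ⟨g5, g6⟩, g7, g8⟩ := allBalanced_node.1 b12
    simp only [w12_node, w1_node, w2_node, weight_node, add_zero] at *
    obtain ⟨⟨e1, e2, e3, e4, e5, e6⟩, ⟨f1, f2, f3, f4⟩, ⟨f5, f6⟩, f7, f8⟩ :=
      doubleRot_gc_bounds P (weight_nonneg t11) (weight_nonneg t121) (weight_nonneg t122)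
      (weight_nonneg t2) h12 h121 h122 g3 g4 hr1 hy
    obtain ⟨c1, c2⟩ := b11.child_le hα
    obtain ⟨c3, c4⟩ := h2.child_le hα
    obtain ⟨c5, c6⟩ := b121.child_le hα
    obtain ⟨c7, c8⟩ := b122.child_le hα
    have G {q A D d : ℝ} := @grandchild_bound α β q A D d hα0 hβ0 P.two_mul_le hα1
    have d1 := G (w1_nonneg _) f7 c5 g5
    have d2 := G (w2_nonneg _) f7 c6 g6
    have d3 := G (w1_nonneg _) f8 c7 g7
    have d4 := G (w2_nonneg _) f8 c8 g8
    refine allBalanced_node.2 ⟨⟨?_, allBalanced_node.2 ⟨⟨⟨f1, f2⟩, b11, b121⟩, ?_⟩,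
      allBalanced_node.2 ⟨⟨⟨f3, f4⟩, b122, h2⟩, ?_⟩⟩, ?_⟩
    all_goals try simp only [w1_node, w2_node, weight_node]
    · constructor <;> linarith
    · refine ⟨⟨?_, ?_⟩, ?_, ?_⟩ <;> linarith
    · refine ⟨⟨?_, ?_⟩, ?_, ?_⟩ <;> linarith
    · refine ⟨⟨?_, ?_⟩, ?_, ?_⟩ <;> linarith
  | case4 hy h =>
    rcases T with _ | ⟨n, t1, _ | ⟨n2, _ | ⟨n21, t211, t212⟩, t22⟩⟩ <;>
      simp [doubleRotMirror] at h
    subst h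
    obtain ⟨⟨hr1, hr2⟩, h1, h2⟩ := hT
    obtain ⟨⟨⟨h11, h12⟩, b11, b12⟩, ⟨g1, g2⟩, g3, g4⟩ := allBalanced_node.1 h2
    obtain ⟨⟨⟨h121, h122⟩, b121, b122⟩, ⟨g5, g6⟩, g7, g8⟩ := allBalanced_node.1 b11
    simp only [w21_node, w1_node, w2_node, weight_node, add_zero] at *
    obtain ⟨⟨e1, e2, e3, e4, e5, e6⟩, ⟨f1, f2, f3, f4⟩, ⟨f5, f6⟩, f7, f8⟩ :=
      doubleRot_gc_bounds P (weight_nonneg t22) (weight_nonneg t212) (weight_nonneg t211)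
      (weight_nonneg t1) (by linarith) (by linarith) (by linarith) (by linarith) (by linarith)
      (by linarith) (by linarith)
    obtain ⟨c1, c2⟩ := b12.child_le hα
    obtain ⟨c3, c4⟩ := h1.child_le hα
    obtain ⟨c5, c6⟩ := b121.child_le hα
    obtain ⟨c7, c8⟩ := b122.child_le hα
    have G {q A D d : ℝ} := @grandchild_bound α β q A D d hα0 hβ0 P.two_mul_le hα1
    rw [add_comm (weight t212)] at f7 f8
    have d1 := G (w1_nonneg _) f8 c5 g5
    have d2 := G (w2_nonneg _) f8 c6 g6
    have d3 := G (w1_nonneg _) f7 c7 g7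
    have d4 := G (w2_nonneg _) f7 c8 g8
    refine allBalanced_node.2 ⟨⟨?_, allBalanced_node.2 ⟨⟨?_, h1, b121⟩, ?_⟩,
      allBalanced_node.2 ⟨⟨?_, b122, b12⟩, ?_⟩⟩, ?_⟩
    all_goals try simp only [w1_node, w2_node, weight_node]
    · constructor <;> linarith
    · constructor <;> linarith
    · refine ⟨⟨?_, ?_⟩, ?_, ?_⟩ <;> linarith
    · constructor <;> linarith
    · refine ⟨⟨?_, ?_⟩, ?_, ?_⟩ <;> linarith
    · refine ⟨⟨?_, ?_⟩, ?_, ?_⟩ <;> linarith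
  | case5 hy =>
    cases T with
    | nil => trivial
    | node k l r =>
      simp only [w11_node, w12_node, w21_node, w22_node, weight_node, add_zero,
        max_le_iff] at hy
      obtain ⟨⟨y1, y2⟩, y3, y4⟩ := hy
      have := mul_le_mul_of_nonneg_right P.y_le
        (add_nonneg (weight_nonneg l) (weight_nonneg r))
      exact allBalanced_node.2 ⟨hT, ⟨y1.trans this, y2.trans this⟩,
        y3.trans this, y4.trans this⟩

/-- A rotation fails only if a node it needs is empty. The triggering grandchild would then weigh
`1/2` in a tree of weight at least 2, or 1 in a tree of weight at least 3, too little for a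
threshold `y ≥ 47/100`. -/
theorem exists_gcBal {y : ℝ} (hy : 47 / 100 ≤ y) (T : BinaryTree K) :
    ∃ T', GCBal y 0 T T' := by
  rcases T with _ | ⟨n, l, r⟩
  · exact ⟨_, .case5 (by simp; linarith)⟩
  by_cases h1 : w1 l > y * (weight l + weight r)
  · rcases l with _ | ⟨n1, t11, t12⟩
    · simp only [w1_nil, weight_nil] at h1
      nlinarith [one_le_weight r]
    · exact ⟨_, .case1 (by simpa using h1) rfl⟩
  by_cases h2 : w2 r > y * (weight l + weight r)
  · rcases r with _ | ⟨n1, t11, t12⟩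
    · simp only [w2_nil, weight_nil] at h2
      nlinarith [one_le_weight l]
    · exact ⟨_, .case2 (by simpa using h2) rfl⟩
  by_cases h3 : w2 l > y * (weight l + weight r)
  · rcases l with _ | ⟨n1, t11, _ | ⟨n12, t121, t122⟩⟩
    · simp only [w2_nil, weight_nil] at h3
      nlinarith [one_le_weight r]
    · simp only [w2_node, weight_node, weight_nil] at h3
      nlinarith [one_le_weight r, one_le_weight t11]
    · exact ⟨_, .case3 (by simpa using h3) rfl⟩
  by_cases h4 : w1 r > y * (weight l + weight r)
  · rcases r with _ | ⟨n1, _ | ⟨n12, t121, t122⟩, t11⟩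
    · simp only [w1_nil, weight_nil] at h4
      nlinarith [one_le_weight l]
    · simp only [w1_node, weight_node, weight_nil] at h4
      nlinarith [one_le_weight l, one_le_weight t11]
    · exact ⟨_, .case4 (by simpa using h4) rfl⟩
  push Not at h1 h2 h3 h4
  exact ⟨_, .case5 (by simp [*])⟩

/-! ### Child-balancing -/

/-- After child-balancing, every node is child-balanced. -/
theorem CBal.balanced {α β v : ℝ} (hα : 7 / 10 ≤ α) (hα2 : 1 / 2 ≤ α ^ 2) (hα' : α ≤ 3 / 4)
    (P : AdmissibleC α v) {k : K} {l r T : BinaryTree K}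
    (hl : AllBalanced α β l) (hr : AllBalanced α β r)
    (hlα : weight l ≤ α * (weight l + weight r) + α)
    (hrα : weight r ≤ α * (weight l + weight r) + α)
    (hN : 12 ≤ weight l + weight r) (h : CBal α v 0 0 (.node k l r) T) :
    ∃ k' l' r', T = .node k' l' r' ∧
      (weight l' ≤ α * (weight l' + weight r') ∧ weight r' ≤ α * (weight l' + weight r')) ∧
      PreBalanced α β l' ∧ PreBalanced α β r' := by
  cases h with
  | case1 h1 h2 h =>
    rcases l with _ | ⟨n1, t11, t12⟩ <;> simp [simpleRot] at h
    subst h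
    obtain ⟨⟨⟨h11, h12⟩, b11, b12⟩, -⟩ := allBalanced_node.1 hl
    simp only [w11_node, w1_node, weight_node, add_zero, sub_zero] at *
    obtain ⟨⟨e1, e2⟩, e3⟩ := simpleRot_c_bounds hα hα' P.le (weight_nonneg r) h11 h1 hlα hN h2
    refine ⟨_, _, _, rfl, ?_, b11.preBalanced, e3, b12, hr⟩
    rw [weight_node]
    constructor <;> linarith
  | case2 h1 h2 h =>
    rcases r with _ | ⟨n2, t21, t22⟩ <;> simp [simpleRotMirror] at h
    subst h
    obtain ⟨⟨⟨h21, h22⟩, b21, b22⟩, -⟩ := allBalanced_node.1 hr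
    simp only [w22_node, w2_node, weight_node, add_zero, sub_zero] at *
    obtain ⟨⟨e1, e2⟩, e3, e4⟩ := simpleRot_c_bounds (A := weight t22) (B := weight t21)
      hα hα' P.le (weight_nonneg l) (by linarith) (by linarith) (by linarith) (by linarith)
      (by linarith)
    refine ⟨_, _, _, rfl, ?_, ⟨?_, hl, b21⟩, b22.preBalanced⟩
    · rw [weight_node]
      constructor <;> linarith
    · constructor <;> linarith
  | case3 h1 h2 h =>
    rcases l with _ | ⟨n1, t11, _ | ⟨n12, t121, t122⟩⟩ <;> simp [doubleRot] at h
    subst h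
    obtain ⟨⟨⟨h11, h12⟩, b11, b12⟩, -⟩ := allBalanced_node.1 hl
    obtain ⟨⟨⟨h121, h122⟩, b121, b122⟩, -⟩ := allBalanced_node.1 b12
    simp only [w11_node, w1_node, weight_node, add_zero, sub_zero] at *
    obtain ⟨⟨e1, e2⟩, e3, e4⟩ := doubleRot_c_bounds hα hα2 hα' P.lower (weight_nonneg t11)
      (weight_nonneg t121) (weight_nonneg t122) h11 h12 h121 h122 h1 hlα hN h2
    refine ⟨_, _, _, rfl, ?_, ⟨e3, b11, b121⟩, e4, b122, hr⟩
    rw [weight_node, weight_node]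
    constructor <;> linarith
  | case4 h1 h2 h =>
    rcases r with _ | ⟨n2, _ | ⟨n21, t211, t212⟩, t22⟩ <;> simp [doubleRotMirror] at h
    subst h
    obtain ⟨⟨⟨h21, h22⟩, b21, b22⟩, -⟩ := allBalanced_node.1 hr
    obtain ⟨⟨⟨h211, h212⟩, b211, b212⟩, -⟩ := allBalanced_node.1 b21
    simp only [w22_node, w2_node, weight_node, add_zero, sub_zero] at *
    obtain ⟨⟨e1, e2⟩, ⟨e3, e4⟩, e5, e6⟩ := doubleRot_c_bounds (A := weight t22)
      (D := weight t212) (E := weight t211) (C := weight l) hα hα2 hα' P.lower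
      (weight_nonneg _) (weight_nonneg _) (weight_nonneg _)
      (by linarith) (by linarith) (by linarith) (by linarith) (by linarith) (by linarith)
      (by linarith) (by linarith)
    refine ⟨_, _, _, rfl, ?_, ⟨?_, hl, b211⟩, ?_, b212, b22⟩
    · rw [weight_node, weight_node]
      constructor <;> linarith
    · constructor <;> linarith
    · constructor <;> linarith
  | case5 h1 =>
    simp only [w1_node, w2_node, weight_node, add_zero, max_le_iff] at h1
    exact ⟨_, _, _, rfl, h1, hl.preBalanced, hr.preBalanced⟩

/-- An overweight child weighs more than `7/10 · 12`. If its inner child were empty, the outer one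
would weigh at most `α / (1 - α) ≤ 3`, so the child itself would weigh at most 4. -/
theorem exists_cBal {α β v : ℝ} (hα : 7 / 10 ≤ α) (hα' : α ≤ 3 / 4)
    {k : K} {l r : BinaryTree K} (hl : AllBalanced α β l) (hr : AllBalanced α β r)
    (hN : 12 ≤ weight l + weight r) : ∃ T, CBal α v 0 0 (.node k l r) T := by
  have hαN : 7 / 10 * 12 ≤ α * (weight l + weight r) := by gcongr
  by_cases h1 : weight l > α * (weight l + weight r)
  · rcases l with _ | ⟨n1, t11, t12⟩
    · rw [weight_nil] at *; linarith
    by_cases h2 : weight t11 ≥ (1 - v) * (weight t11 + weight t12 + weight r)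
    · exact ⟨_, .case1 (by simpa using h1) (by simpa using h2) rfl⟩
    rcases t12 with _ | ⟨n12, t121, t122⟩
    · have h := (allBalanced_node.1 hl).1.1.1
      simp only [weight_node, weight_nil] at *
      nlinarith [one_le_weight t11]
    · exact ⟨_, .case3 (by simpa using h1) (by simpa using h2) rfl⟩
  by_cases h2 : weight r > α * (weight l + weight r)
  · rcases r with _ | ⟨n2, t21, t22⟩
    · rw [weight_nil] at *; linarith
    by_cases h3 : weight t22 ≥ (1 - v) * (weight l + (weight t21 + weight t22))
    · exact ⟨_, .case2 (by simpa using h2) (by simpa using h3) rfl⟩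
    rcases t21 with _ | ⟨n21, t211, t212⟩
    · have h := (allBalanced_node.1 hr).1.1.2
      simp only [weight_node, weight_nil] at *
      nlinarith [one_le_weight t22]
    · exact ⟨_, .case4 (by simpa using h2) (by simpa using h3) rfl⟩
  push Not at h1 h2
  exact ⟨_, .case5 (by simp [*])⟩

/-! ### The whole balancing step -/

/-- GC-steps at the two children do not alter their weights, so the child-balance obtained at the
root survives until the final GC-step. -/
theorem CGCBal.allBalanced {α β v y : ℝ} (Pβ : Admissible α β β) (Py : Admissible α β y)
    (Pv : AdmissibleC α v) {k : K} {l r : BinaryTree K} (hl : AllBalanced α β l)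
    (hr : AllBalanced α β r) (hN : 12 ≤ weight l + weight r)
    (hlα : weight l ≤ α * (weight l + weight r) + α)
    (hrα : weight r ≤ α * (weight l + weight r) + α)
    {T : BinaryTree K} (h : CGCBal α v β y (.node k l r) T) : AllBalanced α β T := by
  have C {T₁ : BinaryTree K} := CBal.balanced (T := T₁) (k := k) Pβ.lower Pβ.half_le Pβ.upper Pv
    hl hr hlα hrα hN
  cases h with
  | @modified k' _ _ l' r' _ h _ hl' hr' h' =>
    obtain ⟨_, _, _, e, hc, p1, p2⟩ := C h
    injection e with e1 e2 e3
    subst e1 e2 e3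
    have hp : PreBalanced α β (.node k' l' r') := by
      refine ⟨?_, hl'.allBalanced Py p1, hr'.allBalanced Py p2⟩
      rwa [weight_eq_of_keys_eq hl'.keys_eq, weight_eq_of_keys_eq hr'.keys_eq]
    exact h'.allBalanced Py hp
  | unmodified h h' =>
    obtain ⟨_, _, _, e, hc, -, -⟩ := C h
    injection e with e1 e2 e3
    subst e1 e2 e3
    have hp : PreBalanced α β (.node k l r) := ⟨hc, hl, hr⟩
    exact h'.allBalanced Pβ hp

theorem exists_cgcBal {α β v y : ℝ} (Pβ : Admissible α β β) (Py : Admissible α β y)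
    {k : K} {l r : BinaryTree K} (hl : AllBalanced α β l)
    (hr : AllBalanced α β r) (hN : 12 ≤ weight l + weight r) :
    ∃ T, CGCBal α v β y (.node k l r) T := by
  obtain ⟨T₁, h⟩ := exists_cBal (v := v) (k := k) Pβ.lower Pβ.upper hl hr hN
  by_cases e : T₁ = .node k l r
  · subst e
    obtain ⟨T, hT⟩ := exists_gcBal Pβ.y_lower (.node k l r)
    exact ⟨T, .unmodified h hT⟩
  rcases T₁ with _ | ⟨k₁, l₁, r₁⟩
  · have := h.keys_eq
    simp [keys] at this
  obtain ⟨l', hl'⟩ := exists_gcBal Py.y_lower l₁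
  obtain ⟨r', hr'⟩ := exists_gcBal Py.y_lower r₁
  obtain ⟨T, hT⟩ := exists_gcBal Py.y_lower (.node k₁ l' r')
  exact ⟨T, .modified h (Ne.symm e) hl' hr' hT⟩

/-! ### Perfectly balanced trees -/

theorem PerfectlyBalanced.weight_le {k : K} {l r : BinaryTree K}
    (h : PerfectlyBalanced (.node k l r)) :
    weight l ≤ weight r + 1 ∧ weight r ≤ weight l + 1 := by
  unfold weight
  exact ⟨by exact_mod_cast h.1, by exact_mod_cast h.2.1⟩

theorem PerfectlyBalanced.w_le {β c : ℝ} {T : BinaryTree K} (h : PerfectlyBalanced T)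
    (hβ : 47 / 100 ≤ β) (hc : 1 ≤ c) (hT : weight T ≤ c + 1) :
    w1 T ≤ β * (weight T + c) ∧ w2 T ≤ β * (weight T + c) := by
  have := mul_le_mul_of_nonneg_right hβ
    (add_nonneg (weight_nonneg T) (show 0 ≤ c by linarith))
  rcases T with _ | ⟨k, l, r⟩
  · simp only [w1_nil, w2_nil, weight_nil] at *
    constructor <;> linarith
  · obtain ⟨h1, h2⟩ := h.weight_le
    have h3 := one_le_weight l
    have h4 := one_le_weight r
    simp only [w1_node, w2_node, weight_node] at *
    constructor <;> linarith

/-- The worst child ratio is `2/3`, for weights 2 and 1; the worst grandchild ratio is `2/5`, for a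
child split into 2 and 1 beside a sibling of weight 2. -/
theorem PerfectlyBalanced.allBalanced {α β : ℝ} (hα : 2 / 3 ≤ α) (hβ : 47 / 100 ≤ β)
    {T : BinaryTree K} (h : PerfectlyBalanced T) : AllBalanced α β T := by
  induction T with
  | nil => trivial
  | node k l r hl hr =>
    obtain ⟨h1, h2⟩ := h.weight_le
    obtain ⟨-, -, pl, pr⟩ := h
    have h3 := one_le_weight l
    have h4 := one_le_weight r
    have := mul_le_mul_of_nonneg_right hα (add_nonneg (weight_nonneg l) (weight_nonneg r))
    refine allBalanced_node.2 ⟨⟨⟨by linarith, by linarith⟩, hl pl, hr pr⟩,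
      pl.w_le hβ h4 h1, ?_⟩
    rw [add_comm]
    exact pr.w_le hβ h3 h2

/-- Among the trees of a given weight, perfectly balanced trees have the smallest maximal child
weight. -/
theorem PerfectlyBalanced.child_le_max {T T' : BinaryTree K} (h : PerfectlyBalanced T')
    (hw : weight T' = weight T) :
    w1 T' ≤ max (w1 T) (w2 T) ∧ w2 T' ≤ max (w1 T) (w2 T) := by
  rcases T' with _ | ⟨k', l', r'⟩ <;> rcases T with _ | ⟨k, l, r⟩
  · simp
  · have h1 := one_le_weight l
    have h2 := one_le_weight r
    simp only [weight_nil, weight_node] at hw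
    linarith
  · have h1 := one_le_weight l'
    have h2 := one_le_weight r'
    simp only [weight_nil, weight_node] at hw
    linarith
  · obtain ⟨h1, h2, -⟩ := h
    simp only [weight, Nat.cast_inj, BinaryTree.numLeaves] at hw
    simp only [w1_node, w2_node, weight, ← Nat.cast_max, Nat.cast_le]
    omega

theorem exists_perfectlyBalanced (L : List K) :
    ∃ T : BinaryTree K, PerfectlyBalanced T ∧ keys T = L := by
  induction hn : L.length using Nat.strong_induction_on generalizing L with
  | _ n ih =>
    subst hn
    rcases Nat.eq_zero_or_pos L.length with h | h
    · exact ⟨.nil, trivial, by simp [keys, List.length_eq_zero_iff.1 h]⟩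
    have hh : L.length / 2 < L.length := by omega
    obtain ⟨l, hl, el⟩ := ih _ (by simp; omega) (L.take (L.length / 2)) rfl
    obtain ⟨r, hr, er⟩ := ih _ (by simp; omega) (L.drop (L.length / 2 + 1)) rfl
    have e1 := length_keys l
    have e2 := length_keys r
    rw [el, List.length_take] at e1
    rw [er, List.length_drop] at e2
    refine ⟨.node L[L.length / 2] l r, ⟨by omega, by omega, hl, hr⟩, ?_⟩
    rw [keys, el, er, ← List.drop_eq_getElem_cons, List.take_append_drop]

/-! ### Keys of search trees -/

theorem weight_eq_length_keys (T : BinaryTree K) : weight T = (keys T).length + 1 := by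
  unfold weight
  exact_mod_cast (length_keys T).symm

theorem exists_keys_eq_cons {b : K} {T : BinaryTree K} (h : leftmostKey T = some b) :
    ∃ L, keys T = b :: L := by
  induction T with
  | nil => simp [leftmostKey] at h
  | node k l r ih _ =>
    rcases l with _ | ⟨k', l', r'⟩
    · simp only [leftmostKey, Option.some.injEq] at h
      exact ⟨keys r, by simp [keys, h]⟩
    · obtain ⟨L, hL⟩ := ih h
      exact ⟨L ++ k :: keys r, by rw [keys, hL]; rfl⟩

theorem exists_leftmostKey (k : K) (l r : BinaryTree K) :
    ∃ b, leftmostKey (.node k l r) = some b := by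
  induction l generalizing k r with
  | nil => exact ⟨k, rfl⟩
  | node k' l' r' ih _ => exact ih k' r'

section LinearOrder

variable [LinearOrder K]

/-- Being a search tree depends only on the list of keys, hence is invariant under rotations. -/
theorem isBST_iff_pairwise {T : BinaryTree K} : IsBST T ↔ (keys T).Pairwise (· < ·) := by
  induction T with
  | nil => simp [IsBST, keys]
  | node k l r hl hr =>
    simp only [IsBST, keys, List.pairwise_append, List.pairwise_cons, hl, hr, List.mem_cons,
      forall_eq_or_imp]
    constructor
    · rintro ⟨h1, h2, h3, h4⟩
      exact ⟨h3, ⟨h2, h4⟩, fun a ha ↦ ⟨h1 a ha, fun b hb ↦ (h1 a ha).trans (h2 b hb)⟩⟩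
    · rintro ⟨h3, ⟨h2, h4⟩, h⟩
      exact ⟨fun a ha ↦ (h a ha).1, h2, h3, h4⟩

theorem orderedInsert_append_cons_of_le {x k : K} (A B : List K) (h : x ≤ k) :
    (A ++ k :: B).orderedInsert (· ≤ ·) x = A.orderedInsert (· ≤ ·) x ++ k :: B := by
  induction A with
  | nil => simp [h]
  | cons a A ih =>
    simp only [List.cons_append, List.orderedInsert_cons, ih]
    split_ifs <;> rfl

theorem orderedInsert_append_of_lt {x : K} {A : List K} (B : List K) (h : ∀ a ∈ A, a < x) :
    (A ++ B).orderedInsert (· ≤ ·) x = A ++ B.orderedInsert (· ≤ ·) x := by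
  induction A with
  | nil => simp
  | cons a A ih =>
    simp only [List.mem_cons, forall_eq_or_imp] at h
    simp [List.orderedInsert_cons, ih h.2, h.1]

theorem erase_append_of_notMem_right {x : K} (A : List K) {B : List K} (h : x ∉ B) :
    (A ++ B).erase x = A.erase x ++ B := by
  by_cases hA : x ∈ A
  · exact List.erase_append_left _ hA
  · rw [List.erase_append_right _ hA, List.erase_of_not_mem h, List.erase_of_not_mem hA]

theorem IsBST.notMem_right {x k : K} {l r : BinaryTree K} (h : IsBST (.node k l r))
    (hx : x < k) : x ∉ k :: keys r := by
  simp only [List.mem_cons, not_or]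
  exact ⟨hx.ne, fun hr ↦ (hx.trans (h.2.1 x hr)).false⟩

theorem IsBST.notMem_left {x k : K} {l r : BinaryTree K} (h : IsBST (.node k l r))
    (hx : k ≤ x) : x ∉ keys l := fun hl ↦ (hx.trans_lt (h.1 x hl)).false

/-! ### Updates -/

/-- The ordered list of keys after the insertion of `x`. -/
def insertKey (x : K) (L : List K) : List K :=
  if x ∈ L then L else L.orderedInsert (· ≤ ·) x

theorem IsBST.insertKey_left {x k : K} {l r : BinaryTree K} (h : IsBST (.node k l r))
    (hx : x < k) : insertKey x (keys (.node k l r)) = insertKey x (keys l) ++ k :: keys r := by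
  have := h.notMem_right hx
  simp only [insertKey, keys, List.mem_append, this, or_false,
    orderedInsert_append_cons_of_le _ _ hx.le]
  split_ifs <;> rfl

theorem IsBST.insertKey_right {x k : K} {l r : BinaryTree K} (h : IsBST (.node k l r))
    (hx : k < x) : insertKey x (keys (.node k l r)) = keys l ++ k :: insertKey x (keys r) := by
  have := h.notMem_left hx.le
  simp only [insertKey, keys, List.mem_append, this, false_or, List.mem_cons, hx.ne',
    orderedInsert_append_of_lt _ fun a ha ↦ (h.1 a ha).trans hx, List.orderedInsert_cons,
    hx.not_ge, if_false]
  split_ifs <;> rfl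

theorem IsBST.erase_left {x k : K} {l r : BinaryTree K} (h : IsBST (.node k l r))
    (hx : x < k) : (keys (.node k l r)).erase x = (keys l).erase x ++ k :: keys r :=
  erase_append_of_notMem_right _ (h.notMem_right hx)

theorem IsBST.erase_right {x k : K} {l r : BinaryTree K} (h : IsBST (.node k l r))
    (hx : k < x) : (keys (.node k l r)).erase x = keys l ++ k :: (keys r).erase x := by
  rw [keys, List.erase_append_right _ (h.notMem_left hx.le), List.erase_cons_tail]
  simpa using hx.ne

theorem length_insertKey (x : K) (L : List K) :
    (insertKey x L).length = L.length + if x ∈ L then 0 else 1 := by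
  unfold insertKey
  split_ifs <;> simp [List.orderedInsert_length]

end LinearOrder

/-- For redundant updates: the subtree may be rebuilt with the same weight and its parent left
alone. The maximum is needed because rebuilding may move the heavier side from left to right. -/
theorem AllBalanced.replace_left {α β : ℝ} {k : K} {l l' r : BinaryTree K}
    (h : AllBalanced α β (.node k l r)) (hl' : AllBalanced α β l') (hw : weight l' = weight l)
    (hm : w1 l' ≤ max (w1 l) (w2 l) ∧ w2 l' ≤ max (w1 l) (w2 l)) :
    AllBalanced α β (.node k l' r) := by
  obtain ⟨⟨hc, hl, hr⟩, ⟨g1, g2⟩, g3⟩ := allBalanced_node.1 h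
  rw [← hw] at hc g1 g2 g3
  have := max_le g1 g2
  exact allBalanced_node.2 ⟨⟨hc, hl', hr⟩, ⟨hm.1.trans this, hm.2.trans this⟩, g3⟩

theorem AllBalanced.replace_right {α β : ℝ} {k : K} {l r r' : BinaryTree K}
    (h : AllBalanced α β (.node k l r)) (hr' : AllBalanced α β r') (hw : weight r' = weight r)
    (hm : w1 r' ≤ max (w1 r) (w2 r) ∧ w2 r' ≤ max (w1 r) (w2 r)) :
    AllBalanced α β (.node k l r') := by
  obtain ⟨⟨hc, hl, hr⟩, g1, g2, g3⟩ := allBalanced_node.1 h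
  rw [← hw] at hc g1 g2 g3
  have := max_le g2 g3
  exact allBalanced_node.2 ⟨⟨hc, hl, hr'⟩, g1, hm.1.trans this, hm.2.trans this⟩

/-! ### Slack and balancing at one step of an update -/

/-- What the proofs use about the parameters of the update algorithm. -/
structure AdmissibleUpdate (α β : ℝ) : Prop where
  c : AdmissibleC α (alphaHat α)
  gc : Admissible α β β
  gcHat : Admissible α β (betaHat α β)

theorem admissibleUpdate {α β : ℝ} (hα : 1 / √2 ≤ α) (hα' : α < 3 / 4) (hβ : scrB α ≤ β)
    (hβ' : β ≤ α ^ 2) : AdmissibleUpdate α β := by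
  obtain ⟨h0, h2⟩ := half_le_sq hα
  obtain ⟨hs0, hs⟩ := scrB_spec h0.le
  obtain ⟨b1, b2⟩ := betaHat_bounds h2 h0 hα'.le hβ hβ'
  exact ⟨admissibleC_alphaHat h2 h0 hα'.le,
    admissible_of_root hs0 hs h2 hα'.le hβ hβ' hβ le_rfl,
    admissible_of_root hs0 hs h2 hα'.le hβ hβ' b1 b2⟩

/-- The subtrees `l`, `r` are sufficiently balanced for the balancing step. -/
structure Balanceable (α β : ℝ) (l r : BinaryTree K) : Prop where
  left : AllBalanced α β l
  right : AllBalanced α β r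
  left_le : weight l ≤ α * (weight l + weight r) + α
  right_le : weight r ≤ α * (weight l + weight r) + α
  twelve_le : 12 ≤ weight l + weight r

theorem Finish.spec {α β : ℝ} (P : AdmissibleUpdate α β) {red : Prop} {k : K}
    {l r T : BinaryTree K} (B : Balanceable α β l r)
    (hred : red → AllBalanced α β (.node k l r)) (h : Finish α β red (.node k l r) T) :
    AllBalanced α β T ∧ keys T = keys (.node k l r) ∧ (red → T = .node k l r) := by
  rcases h with ⟨h, rfl⟩ | ⟨h, hT⟩
  · exact ⟨hred h, rfl, fun _ ↦ rfl⟩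
  · exact ⟨hT.allBalanced P.gc P.gcHat P.c B.left B.right B.twelve_le B.left_le B.right_le,
      hT.keys_eq, fun hr ↦ absurd hr h⟩

theorem exists_finish {α β : ℝ} (P : AdmissibleUpdate α β) (red : Prop) (k : K)
    {l r : BinaryTree K} (B : Balanceable α β l r) : ∃ T, Finish α β red (.node k l r) T := by
  by_cases h : red
  · exact ⟨_, .inl ⟨h, rfl⟩⟩
  · obtain ⟨T, hT⟩ := exists_cgcBal (v := alphaHat α) (k := k) P.gc P.gcHat B.left B.right
      B.twelve_le
    exact ⟨T, .inr ⟨h, hT⟩⟩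

theorem thirteen_le_weight {k : K} {l r : BinaryTree K}
    (h : 12 ≤ (BinaryTree.node k l r).numNodes) : 13 ≤ weight l + weight r := by
  rw [← weight_node k]
  unfold weight
  rw [BinaryTree.numLeaves_eq_numNodes_succ]
  exact_mod_cast Nat.succ_le_succ h

/-- The slack `α` comes from a deletion beside the heavy child, as `α(N + 1) = αN + α`; an insertion
inside that child costs only `1 - α ≤ α`. A weight of at least 13 stays at least 12. -/
theorem AllBalanced.balanceable_left {α β : ℝ} (P : AdmissibleUpdate α β) {k : K}
    {l l' r : BinaryTree K} (hN : 12 ≤ (BinaryTree.node k l r).numNodes)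
    (h : AllBalanced α β (.node k l r)) (hl' : AllBalanced α β l')
    (hw : weight l ≤ weight l' + 1) (hw' : weight l' ≤ weight l + 1) :
    Balanceable α β l' r := by
  obtain ⟨⟨⟨h1, h2⟩, hl, hr⟩, -⟩ := allBalanced_node.1 h
  have := thirteen_le_weight hN
  have hα := P.gc.lower
  have hα' := P.gc.upper
  have a1 := mul_le_mul_of_nonneg_left hw (show 0 ≤ α by linarith)
  have a2 := mul_le_mul_of_nonneg_left hw' (show 0 ≤ 1 - α by linarith)
  exact ⟨hl', hr, by linarith, by linarith, by linarith⟩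

theorem AllBalanced.balanceable_right {α β : ℝ} (P : AdmissibleUpdate α β) {k : K}
    {l r r' : BinaryTree K} (hN : 12 ≤ (BinaryTree.node k l r).numNodes)
    (h : AllBalanced α β (.node k l r)) (hr' : AllBalanced α β r')
    (hw : weight r ≤ weight r' + 1) (hw' : weight r' ≤ weight r + 1) :
    Balanceable α β l r' := by
  obtain ⟨⟨⟨h1, h2⟩, hl, hr⟩, -⟩ := allBalanced_node.1 h
  have := thirteen_le_weight hN
  have hα := P.gc.lower
  have hα' := P.gc.upper
  have a1 := mul_le_mul_of_nonneg_left hw (show 0 ≤ α by linarith)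
  have a2 := mul_le_mul_of_nonneg_left hw' (show 0 ≤ 1 - α by linarith)
  exact ⟨hl, hr', by linarith, by linarith, by linarith⟩

section LinearOrder

variable [LinearOrder K]

theorem weight_of_keys_eq_insertKey {x : K} {T T' : BinaryTree K}
    (h : keys T' = insertKey x (keys T)) :
    weight T ≤ weight T' + 1 ∧ weight T' ≤ weight T + 1 := by
  simp only [weight_eq_length_keys, h, length_insertKey]
  split_ifs <;> push_cast <;> constructor <;> linarith

theorem weight_of_keys_eq_erase {x : K} {T T' : BinaryTree K}
    (h : keys T' = (keys T).erase x) :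
    weight T ≤ weight T' + 1 ∧ weight T' ≤ weight T + 1 := by
  simp only [weight_eq_length_keys, h]
  have h1 : (keys T).length ≤ ((keys T).erase x).length + 1 := by
    rw [List.length_erase]; split_ifs <;> omega
  have h2 : ((keys T).erase x).length ≤ (keys T).length := List.length_erase_le
  exact ⟨by exact_mod_cast Nat.succ_le_succ h1, by exact_mod_cast (by omega)⟩

/-- The child weights of an updated tree are controlled if the update was redundant: this is what
the balance of its parent requires, since the parent is not rebalanced. -/
theorem BUInsert.spec {α β : ℝ} (P : AdmissibleUpdate α β) {x : K} {T T' : BinaryTree K}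
    (h : BUInsert α β x T T') (hb : IsBST T) (ha : AllBalanced α β T) :
    AllBalanced α β T' ∧ keys T' = insertKey x (keys T) ∧
      (x ∈ keys T → w1 T' ≤ max (w1 T) (w2 T) ∧ w2 T' ≤ max (w1 T) (w2 T)) := by
  induction h with
  | @small T T' hN hp hk =>
    refine ⟨hp.allBalanced (by linarith [P.gc.lower]) P.gc.y_lower, hk, fun hx ↦ ?_⟩
    rw [if_pos hx] at hk
    exact hp.child_le_max (weight_eq_of_keys_eq hk)
  | @left k l r l' T' hN hx h hf ih =>
    obtain ⟨a1, a2, a3⟩ := ih hb.2.2.1 ha.2.2.1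
    obtain ⟨w, w'⟩ := weight_of_keys_eq_insertKey a2
    have hw (hxl : x ∈ keys l) : weight l' = weight l :=
      weight_eq_of_keys_eq (by rw [a2, insertKey, if_pos hxl])
    obtain ⟨c1, c2, c3⟩ := hf.spec P (ha.balanceable_left P hN a1 w w')
      fun hxl ↦ ha.replace_left a1 (hw hxl) (a3 hxl)
    refine ⟨c1, by rw [c2, hb.insertKey_left hx, keys, a2], fun hxT ↦ ?_⟩
    have hxl : x ∈ keys l := by
      simpa [keys, List.mem_append, hb.notMem_right hx] using hxT
    simp [c3 hxl, hw hxl]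
  | @right k l r r' T' hN hx h hf ih =>
    obtain ⟨a1, a2, a3⟩ := ih hb.2.2.2 ha.2.2.2
    obtain ⟨w, w'⟩ := weight_of_keys_eq_insertKey a2
    have hw (hxr : x ∈ keys r) : weight r' = weight r :=
      weight_eq_of_keys_eq (by rw [a2, insertKey, if_pos hxr])
    obtain ⟨c1, c2, c3⟩ := hf.spec P (ha.balanceable_right P hN a1 w w')
      fun hxr ↦ ha.replace_right a1 (hw hxr) (a3 hxr)
    refine ⟨c1, by rw [c2, hb.insertKey_right hx, keys, a2], fun hxT ↦ ?_⟩
    have hxr : x ∈ keys r := by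
      simpa [keys, hb.notMem_left hx.le, hx.ne'] using hxT
    simp [c3 hxr, hw hxr]
  | @root l r hN =>
    refine ⟨ha, ?_, fun _ ↦ ⟨le_max_left _ _, le_max_right _ _⟩⟩
    simp [insertKey, keys]

theorem BUDelete.spec {α β : ℝ} (P : AdmissibleUpdate α β) {x : K} {T T' : BinaryTree K}
    (h : BUDelete α β x T T') (hb : IsBST T) (ha : AllBalanced α β T) :
    AllBalanced α β T' ∧ keys T' = (keys T).erase x ∧
      (x ∉ keys T → w1 T' ≤ max (w1 T) (w2 T) ∧ w2 T' ≤ max (w1 T) (w2 T)) := by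
  induction h with
  | @small x T T' hN hp hk =>
    refine ⟨hp.allBalanced (by linarith [P.gc.lower]) P.gc.y_lower, hk, fun hx ↦ ?_⟩
    rw [List.erase_of_not_mem hx] at hk
    exact hp.child_le_max (weight_eq_of_keys_eq hk)
  | @left x k l r l' T' hN hx h hf ih =>
    obtain ⟨a1, a2, a3⟩ := ih hb.2.2.1 ha.2.2.1
    obtain ⟨w, w'⟩ := weight_of_keys_eq_erase a2
    have hw (hxl : x ∉ keys l) : weight l' = weight l :=
      weight_eq_of_keys_eq (by rw [a2, List.erase_of_not_mem hxl])
    obtain ⟨c1, c2, c3⟩ := hf.spec P (ha.balanceable_left P hN a1 w w')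
      fun hxl ↦ ha.replace_left a1 (hw hxl) (a3 hxl)
    refine ⟨c1, by rw [c2, hb.erase_left hx, keys, a2], fun hxT ↦ ?_⟩
    have hxl : x ∉ keys l := fun hxl ↦ hxT (by simp [keys, hxl])
    simp [c3 hxl, hw hxl]
  | @right x k l r r' T' hN hx h hf ih =>
    obtain ⟨a1, a2, a3⟩ := ih hb.2.2.2 ha.2.2.2
    obtain ⟨w, w'⟩ := weight_of_keys_eq_erase a2
    have hw (hxr : x ∉ keys r) : weight r' = weight r :=
      weight_eq_of_keys_eq (by rw [a2, List.erase_of_not_mem hxr])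
    obtain ⟨c1, c2, c3⟩ := hf.spec P (ha.balanceable_right P hN a1 w w')
      fun hxr ↦ ha.replace_right a1 (hw hxr) (a3 hxr)
    refine ⟨c1, by rw [c2, hb.erase_right hx, keys, a2], fun hxT ↦ ?_⟩
    have hxr : x ∉ keys r := fun hxr ↦ hxT (by simp [keys, hxr])
    simp [c3 hxr, hw hxr]
  | @root x b l r r' T' hN hs h hf ih =>
    obtain ⟨a1, a2, -⟩ := ih hb.2.2.2 ha.2.2.2
    obtain ⟨w, w'⟩ := weight_of_keys_eq_erase a2
    -- Deleting the successor, which does occur in `r`, is never redundant.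
    obtain ⟨c1, c2, -⟩ := hf.spec P (ha.balanceable_right P hN a1 w w') False.elim
    obtain ⟨L, hL⟩ := exists_keys_eq_cons hs
    refine ⟨c1, ?_, fun hxT ↦ absurd (by simp [keys]) hxT⟩
    rw [c2, keys, keys, List.erase_append_right _ (hb.notMem_left le_rfl), a2, hL]
    simp

/-! ### Existence of a result for every update -/

theorem exists_buInsert {α β : ℝ} (P : AdmissibleUpdate α β) (x : K) {T : BinaryTree K}
    (hb : IsBST T) (ha : AllBalanced α β T) : ∃ T', BUInsert α β x T T' := by
  induction T with
  | nil =>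
    obtain ⟨T', hp, hk⟩ := exists_perfectlyBalanced (insertKey x (keys (.nil : BinaryTree K)))
    exact ⟨T', .small (by simp) hp hk⟩
  | node k l r ihl ihr =>
    rcases le_or_gt (BinaryTree.node k l r).numNodes 11 with hN | hN
    · obtain ⟨T', hp, hk⟩ := exists_perfectlyBalanced (insertKey x (keys (.node k l r)))
      exact ⟨T', .small hN hp hk⟩
    rcases lt_trichotomy x k with hx | rfl | hx
    · obtain ⟨l', hl'⟩ := ihl hb.2.2.1 ha.2.2.1
      obtain ⟨a1, a2, -⟩ := hl'.spec P hb.2.2.1 ha.2.2.1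
      obtain ⟨w, w'⟩ := weight_of_keys_eq_insertKey a2
      obtain ⟨T', hT'⟩ := exists_finish P (x ∈ keys l) k (ha.balanceable_left P hN a1 w w')
      exact ⟨T', .left hN hx hl' hT'⟩
    · exact ⟨_, .root hN⟩
    · obtain ⟨r', hr'⟩ := ihr hb.2.2.2 ha.2.2.2
      obtain ⟨a1, a2, -⟩ := hr'.spec P hb.2.2.2 ha.2.2.2
      obtain ⟨w, w'⟩ := weight_of_keys_eq_insertKey a2
      obtain ⟨T', hT'⟩ := exists_finish P (x ∈ keys r) k (ha.balanceable_right P hN a1 w w')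
      exact ⟨T', .right hN hx hr' hT'⟩

theorem exists_buDelete {α β : ℝ} (P : AdmissibleUpdate α β) (x : K) {T : BinaryTree K}
    (hb : IsBST T) (ha : AllBalanced α β T) : ∃ T', BUDelete α β x T T' := by
  -- Deleting the root's key recurses with another key, the successor.
  induction T generalizing x with
  | nil =>
    obtain ⟨T', hp, hk⟩ := exists_perfectlyBalanced ((keys (.nil : BinaryTree K)).erase x)
    exact ⟨T', .small (by simp) hp hk⟩
  | node k l r ihl ihr =>
    rcases le_or_gt (BinaryTree.node k l r).numNodes 11 with hN | hN
    · obtain ⟨T', hp, hk⟩ := exists_perfectlyBalanced ((keys (.node k l r)).erase x)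
      exact ⟨T', .small hN hp hk⟩
    have R (z : K) : ∃ r', BUDelete α β z r r' ∧ Balanceable α β l r' := by
      obtain ⟨r', hr'⟩ := ihr z hb.2.2.2 ha.2.2.2
      obtain ⟨a1, a2, -⟩ := hr'.spec P hb.2.2.2 ha.2.2.2
      obtain ⟨w, w'⟩ := weight_of_keys_eq_erase a2
      exact ⟨r', hr', ha.balanceable_right P hN a1 w w'⟩
    rcases lt_trichotomy x k with hx | rfl | hx
    · obtain ⟨l', hl'⟩ := ihl x hb.2.2.1 ha.2.2.1
      obtain ⟨a1, a2, -⟩ := hl'.spec P hb.2.2.1 ha.2.2.1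
      obtain ⟨w, w'⟩ := weight_of_keys_eq_erase a2
      obtain ⟨T', hT'⟩ := exists_finish P (x ∉ keys l) k (ha.balanceable_left P hN a1 w w')
      exact ⟨T', .left hN hx hl' hT'⟩
    -- If `r` were empty, child-balance with `α ≤ 3/4` would give `|l| ≤ 3`, although the total
    -- weight is at least 13.
    · obtain ⟨b, hs⟩ : ∃ b, leftmostKey r = some b := by
        rcases r with _ | ⟨k', l', r'⟩
        · have h1 := (allBalanced_node.1 ha).1.1.1
          have h2 := thirteen_le_weight hN
          simp only [weight_nil] at h1 h2
          nlinarith [P.gc.upper]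
        · exact exists_leftmostKey k' l' r'
      obtain ⟨r', hr', B⟩ := R b
      obtain ⟨T', hT'⟩ := exists_finish P False b B
      exact ⟨T', .root hN hs hr' hT'⟩
    · obtain ⟨r', hr', B⟩ := R x
      obtain ⟨T', hT'⟩ := exists_finish P (x ∉ keys r) k B
      exact ⟨T', .right hN hx hr' hT'⟩

theorem mem_insertKey {x y : K} {L : List K} : y ∈ insertKey x L ↔ y = x ∨ y ∈ L := by
  unfold insertKey
  split_ifs with h
  · exact ⟨.inr, fun h' ↦ h'.elim (fun e ↦ e ▸ h) id⟩
  · simp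

theorem pairwise_insertKey {x : K} {L : List K} (h : L.Pairwise (· < ·)) :
    (insertKey x L).Pairwise (· < ·) := by
  unfold insertKey
  split_ifs with hx
  · exact h
  have h1 : (L.orderedInsert (· ≤ ·) x).Pairwise (· ≤ ·) :=
    (h.imp fun h ↦ le_of_lt h).orderedInsert x L
  have h2 : (L.orderedInsert (· ≤ ·) x).Nodup :=
    (List.perm_orderedInsert _ x L).nodup_iff.2 (List.nodup_cons.2 ⟨hx, h.imp fun h ↦ ne_of_lt h⟩)
  exact (h1.and h2).imp fun h ↦ lt_of_le_of_ne h.1 h.2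

end LinearOrder

end GCB

/-- Bottom-up insertions in, and deletions from, grandchildren-balanced trees can always be
carried out, and they yield grandchildren-balanced trees with the expected keys. -/
theorem theorem3 {K : Type*} [LinearOrder K] (α β : ℝ)
    (hα : 1 / √2 ≤ α) (hα' : α < 3 / 4) (hβ : GCB.scrB α ≤ β) (hβ' : β ≤ α ^ 2)
    (T : BinaryTree K) (hT : GCB.IsGCBTree α β T) (x : K) :
    ((∃ T' : BinaryTree K, GCB.BUInsert α β x T T') ∧
      ∀ T' : BinaryTree K, GCB.BUInsert α β x T T' →
        GCB.IsGCBTree α β T' ∧ ∀ y : K, y ∈ GCB.keys T' ↔ y = x ∨ y ∈ GCB.keys T) ∧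
    ((∃ T' : BinaryTree K, GCB.BUDelete α β x T T') ∧
      ∀ T' : BinaryTree K, GCB.BUDelete α β x T T' →
        GCB.IsGCBTree α β T' ∧ ∀ y : K, y ∈ GCB.keys T' ↔ y ≠ x ∧ y ∈ GCB.keys T) := by
  obtain ⟨hb, ha⟩ := hT
  have P := GCB.admissibleUpdate hα hα' hβ hβ'
  have hs := GCB.isBST_iff_pairwise.1 hb
  refine ⟨⟨GCB.exists_buInsert P x hb ha, fun T' h ↦ ?_⟩,
    GCB.exists_buDelete P x hb ha, fun T' h ↦ ?_⟩
  · obtain ⟨h1, h2, -⟩ := h.spec P hb ha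
    refine ⟨⟨GCB.isBST_iff_pairwise.2 (h2 ▸ GCB.pairwise_insertKey hs), h1⟩, fun y ↦ ?_⟩
    rw [h2, GCB.mem_insertKey]
  · obtain ⟨h1, h2, -⟩ := h.spec P hb ha
    refine ⟨⟨GCB.isBST_iff_pairwise.2 (h2 ▸ hs.sublist List.erase_sublist), h1⟩, fun y ↦ ?_⟩
    rw [h2, List.Nodup.mem_erase_iff (hs.imp fun h ↦ ne_of_lt h)]
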